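/- Let $K>1$ and let $G$ be an undirected graph on the single-antenna nodes $0$ (transmitter), $1,\dots,K$ (relays), $K+1$ (receiver), such that $\{0,K+1\}$ is not an edge, all $\{0,k\}$ and $\{k,K+1\}$ with $1\le k\le K$ are edges, and the edges between relays are arbitrary. In each slot, a listening node $a$ receives $y_a=\sum_{b:\{a,b\}\in E}h_{\{a,b\}}x_b+n_a$ with independent noise $n_a\sim\mathcal{CN}(0,1)$; the gains $h_e$ are reciprocal, constant during a block, independent, and circularly symmetric complex Gaussian with positive variances (Rayleigh fading). A relay cannot transmit and listen in the same slot. The transmitter and the relays have power constraint $P$ (averaged over the block). A *scheme* with $n$ slots consists of a joint law of the transmitted block $x=(x_1,\dots,x_n)$ and of causal half-duplex relay strategies (which may use the channel state and a random seed shared with the receiver), subject to the power constraints. If $I$ denotes the mutual information between the transmitted and the received block given the channel and the seed, the outage probability at multiplexing gain $r$ is $P_{\rm out}(P)=\Pr\{I\le n\,r\log P\}$. The diversity gain at $r$ of a family of schemes indexed by $P$ is $d(r)=\liminf_{P\to\infty}\bigl(-\log P_{\rm out}(P)/\log P\bigr)$, and the optimum diversity-multiplexing tradeoff (DMT) $d_{\rm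 opt}(r)$ is the supremum of the diversity gains at $r$ of all families of schemes. The random sequential (RS) amplify-and-forward scheme with parameter $B\ge1$ uses $L=BK$ paths and $S=BK+1$ slots. In slot $i$ ($1\le i\le L$) the transmitter sends the $i$-th symbol of a Gaussian codeword (independent $\mathcal{CN}(0,P)$ symbols) while relay $k=((i-1)\bmod K)+1$ listens; in slot $i+1$ this relay sends what it received in slot $i$, multiplied by a phase $u_i$, $|u_i|=1$, known at the receiver, and by $\alpha_k=\min\bigl\{1,\sqrt{P/(P(|h_{\{0,k\}}|^2+|h_{\{k,(k)\}}|^2)+1)}\bigr\}$, where $(k)$ is the cyclic predecessor of relay $k$ and $h_{\{k,(k)\}}=0$ if $\{k,(k)\}\notin E$. The phases may have any joint law, independent of the channel (for instance independent and uniform, or constant equal to $1$). Then the RS scheme obeys the power constraints, and for every $B\ge1$ and $r\ge0$ its diversity gain satisfies $$d_{RS}(r)\ \ge\ \max\Bigl\{0,\;K(1-r)-\frac rB\Bigr\}.$$ Moreover, for every $r>0$, $d_{\rm opt}(r)=K\max\{0,1-r\}$, and the diversity gain at $r$ of the RS scheme with parameter $B$ converges to $d_{\rm opt}(r)$ as $B\to\infty$;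 that is, the RS scheme attains the optimum DMT. -/

import Mathlib

open MeasureTheory ProbabilityTheory Filter Topology
open scoped ENNReal NNReal

noncomputable section

namespace RelayNet

/-- The circularly symmetric complex Gaussian law `𝒞𝒩(0, v)`: independent real and imaginary
parts, each of law `𝒩(0, v/2)`, so that `E|z|² = v`. -/
def complexGaussian (v : ℝ≥0) : Measure ℂ :=
  ((gaussianReal 0 (v / 2)).prod (gaussianReal 0 (v / 2))).map fun p => (⟨p.1, p.2⟩ : ℂ)

/-! The nodes are `0, …, K + 1`: node `0` is the transmitter, node `K + 1` the receiver, and the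
others are the relays, indexed by `Fin K`. -/

/-- The transmitter. -/
def src (K : ℕ) : Fin (K + 2) := 0

/-- The receiver. -/
def dst (K : ℕ) : Fin (K + 2) := Fin.last (K + 1)

/-- The node of the `k`-th relay. -/
def relay {K : ℕ} (k : Fin K) : Fin (K + 2) := k.castSucc.succ

/-- A two-hop parallel-relay network: no direct link, every relay is connected to the transmitter
and to the receiver; the graph on the relays is arbitrary. -/
structure IsParallelRelay {K : ℕ} (G : SimpleGraph (Fin (K + 2))) : Prop where
  no_direct : ¬ G.Adj (src K) (dst K)
  uplink : ∀ k : Fin K, G.Adj (src K) (relay k)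
  downlink : ∀ k : Fin K, G.Adj (relay k) (dst K)

/-- A realization of the channel: one complex number for every unordered pair of nodes
(reciprocal channels); only those of edges are ever used. -/
abbrev Gains (K : ℕ) := Sym2 (Fin (K + 2)) → ℂ

/-- Rayleigh fading: independent circularly symmetric complex Gaussian gains, of variance `v e`
on the pair `e`. -/
def gainLaw {K : ℕ} (v : Sym2 (Fin (K + 2)) → ℝ≥0) : Measure (Gains K) :=
  Measure.pi fun e => complexGaussian (v e)

open Classical in
/-- The channel gain between two nodes (zero if they are not connected). -/
def gain {K : ℕ} (G : SimpleGraph (Fin (K + 2))) (H : Gains K) (a b : Fin (K + 2)) : ℂ :=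
  if G.Adj a b then H s(a, b) else 0

/-- A transmission scheme over one block (one symbol per slot), with a quasi-static channel.

* `slots` is the number of slots of the block.
* `seedLaw` is the law of a random seed `ℕ → ℝ`, shared by the relays and the receiver.
* `input` is the joint law of the symbols that the transmitter sends in the block.
* In slot `t` relay `k` knows the channel, the seed and what it received in slots `0, …, t - 1`.
  On this basis it either listens (`listens … = true`) or transmits the symbol `send …`. -/
structure Scheme (K : ℕ) where
  slots : ℕ
  seedLaw : Measure (ℕ → ℝ)
  input : Measure (Fin slots → ℂ)
  listens : Gains K → (ℕ → ℝ) → Fin K → (t : ℕ) → (Fin t → ℂ) → Bool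
  send : Gains K → (ℕ → ℝ) → Fin K → (t : ℕ) → (Fin t → ℂ) → ℂ

/-- Extension of a finite sequence by zero. -/
def pad {n : ℕ} (u : Fin n → ℂ) (t : ℕ) : ℂ := if h : t < n then u ⟨t, h⟩ else 0

/-- What node `a` receives in one slot, `∑_b H_{a,b} x_b + n_a`, when the transmitter sends `x`,
the relays send `τ` and the noise at the node is `w`. -/
def received {K : ℕ} (G : SimpleGraph (Fin (K + 2))) (H : Gains K) (a : Fin (K + 2))
    (x : ℂ) (τ : Fin K → ℂ) (w : ℂ) : ℂ :=
  gain G H a (src K) * x + ∑ k : Fin K, gain G H a (relay k) * τ k + w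

namespace Scheme

variable {K : ℕ} (𝒮 : Scheme K)

/-- The output of relay `k` in slot `t` given its past observations: nothing if it listens. -/
def emit (H : Gains K) (s : ℕ → ℝ) (k : Fin K) (t : ℕ) (past : Fin t → ℂ) : ℂ :=
  if 𝒮.listens H s k t past = true then 0 else 𝒮.send H s k t past

/-- The observations of relay `k` in slots `0, …, t - 1`, given the transmitted symbols `x` and
the noise `w` (indexed by node and slot). Relays are half-duplex: a relay that transmits in a
slot observes nothing (recorded as `0`). -/
def observed (G : SimpleGraph (Fin (K + 2))) (H : Gains K) (s : ℕ → ℝ)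
    (x : Fin 𝒮.slots → ℂ) (w : Fin (K + 2) → Fin 𝒮.slots → ℂ) : (t : ℕ) → Fin K → (Fin t → ℂ)
  | 0, _ => Fin.elim0
  | t + 1, k =>
    Fin.snoc (α := fun _ => ℂ) (observed G H s x w t k)
      (if 𝒮.listens H s k t (observed G H s x w t k) = true then
        received G H (relay k) (pad x t)
          (fun l => 𝒮.emit H s l t (observed G H s x w t l)) (pad (w (relay k)) t)
      else 0)

/-- The symbol sent by relay `k` in slot `t`. -/
def relayOutput (G : SimpleGraph (Fin (K + 2))) (H : Gains K) (s : ℕ → ℝ)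
    (x : Fin 𝒮.slots → ℂ) (w : Fin (K + 2) → Fin 𝒮.slots → ℂ) (t : ℕ) (k : Fin K) : ℂ :=
  𝒮.emit H s k t (𝒮.observed G H s x w t k)

/-- The block of symbols observed by the receiver. -/
def output (G : SimpleGraph (Fin (K + 2))) (H : Gains K) (s : ℕ → ℝ)
    (x : Fin 𝒮.slots → ℂ) (w : Fin (K + 2) → Fin 𝒮.slots → ℂ) : Fin 𝒮.slots → ℂ :=
  fun t => received G H (dst K) (x t) (𝒮.relayOutput G H s x w t) (w (dst K) t)

/-- The noise: independent `𝒞𝒩(0, 1)` variables, one for every node and every slot. -/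
def noiseLaw : Measure (Fin (K + 2) → Fin 𝒮.slots → ℂ) :=
  Measure.pi fun _ => Measure.pi fun _ => complexGaussian 1

/-- The joint law of the transmitted and of the received block, for a given channel and seed. -/
def jointLaw (G : SimpleGraph (Fin (K + 2))) (H : Gains K) (s : ℕ → ℝ) :
    Measure ((Fin 𝒮.slots → ℂ) × (Fin 𝒮.slots → ℂ)) :=
  (𝒮.input.prod 𝒮.noiseLaw).map fun p => (p.1, 𝒮.output G H s p.1 p.2)

/-- The mutual information (in nats) between the transmitted and the received block, for a
given channel and seed (both known to the receiver). -/
def mutualInfo (G : SimpleGraph (Fin (K + 2))) (H : Gains K) (s : ℕ → ℝ) : ℝ≥0∞ :=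
  InformationTheory.klDiv (𝒮.jointLaw G H s)
    ((𝒮.jointLaw G H s).fst.prod (𝒮.jointLaw G H s).snd)

/-- The scheme obeys the power constraint `P` (average over the block, at the transmitter and at
every relay, for every channel and seed) and is made of probability laws and measurable maps. -/
structure Admissible (G : SimpleGraph (Fin (K + 2))) (P : ℝ) : Prop where
  prob_seed : IsProbabilityMeasure 𝒮.seedLaw
  prob_input : IsProbabilityMeasure 𝒮.input
  measurable_listens : ∀ k t,
    Measurable fun p : Gains K × (ℕ → ℝ) × (Fin t → ℂ) => 𝒮.listens p.1 p.2.1 k t p.2.2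
  measurable_send : ∀ k t,
    Measurable fun p : Gains K × (ℕ → ℝ) × (Fin t → ℂ) => 𝒮.send p.1 p.2.1 k t p.2.2
  power_input : ∫⁻ x, ∑ t, ‖x t‖ₑ ^ 2 ∂𝒮.input ≤ 𝒮.slots * ENNReal.ofReal P
  power_relay : ∀ H s k,
    ∫⁻ p, ∑ t : Fin 𝒮.slots, ‖𝒮.relayOutput G H s p.1 p.2 t k‖ₑ ^ 2 ∂(𝒮.input.prod 𝒮.noiseLaw)
      ≤ 𝒮.slots * ENNReal.ofReal P

/-- The outage probability at rate `r log P` per slot: the probability, over the fading and the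
seed, that the mutual information of the block is at most `slots * r * log P`. -/
def outage (G : SimpleGraph (Fin (K + 2))) (v : Sym2 (Fin (K + 2)) → ℝ≥0) (r P : ℝ) : ℝ≥0∞ :=
  ((gainLaw v).prod 𝒮.seedLaw)
    {p | 𝒮.mutualInfo G p.1 p.2 ≤ ENNReal.ofReal (𝒮.slots * (r * Real.log P))}

end Scheme

/-- The diversity gain at multiplexing gain `r` of a family of schemes indexed by the power `P`:
the (lower) limit of `- log P_out / log P` as `P → ∞`. -/
def diversityGain {K : ℕ} (G : SimpleGraph (Fin (K + 2))) (v : Sym2 (Fin (K + 2)) → ℝ≥0)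
    (𝒮 : ℝ → Scheme K) (r : ℝ) : EReal :=
  liminf (fun P : ℝ => -ENNReal.log ((𝒮 P).outage G v r P) / (Real.log P : EReal)) atTop

/-- The optimum diversity-multiplexing tradeoff: the supremum of the diversity gains of all
families of schemes that obey the power constraints. -/
def optimalDMT {K : ℕ} (G : SimpleGraph (Fin (K + 2))) (v : Sym2 (Fin (K + 2)) → ℝ≥0)
    (r : ℝ) : EReal :=
  sSup {d | ∃ 𝒮 : ℝ → Scheme K, (∀ P, 0 < P → (𝒮 P).Admissible G P) ∧
    d = diversityGain G v 𝒮 r}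

/-- The cyclic predecessor of a relay. -/
def pred {K : ℕ} (k : Fin K) : Fin K := ⟨(k.val + (K - 1)) % K, Nat.mod_lt _ k.pos⟩

/-- The amplification coefficient of relay `k`: the largest one allowed by the output power
constraint, and at most one. -/
def amplification {K : ℕ} (G : SimpleGraph (Fin (K + 2))) (P : ℝ) (H : Gains K) (k : Fin K) : ℝ :=
  min 1 (√(P / (P * (‖gain G H (relay k) (src K)‖ ^ 2 +
    ‖gain G H (relay k) (relay (pred k))‖ ^ 2) + 1)))

/-- The random sequential amplify-and-forward scheme with `B * K` two-hop paths, the `i`-th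
(`i = 0, …, B * K - 1`) through relay `i % K`, and `B * K + 1` slots. In slot `i` the transmitter
sends the `i`-th symbol of a Gaussian codeword to relay `i % K`; in slot `i + 1` that relay
multiplies what it received in slot `i` by its amplification coefficient and by the phase
`exp (2πi s_i)` and sends it to the receiver. `ν` is the law of the phases (for independent
uniform `s_i` these are the uniformly distributed `1 × 1` unitary matrices, and for `ν` the Dirac
mass at `0` there is no rotation). -/
def rs {K : ℕ} (G : SimpleGraph (Fin (K + 2))) (ν : Measure (ℕ → ℝ)) (B : ℕ) (P : ℝ) :
    Scheme K where
  slots := B * K + 1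
  seedLaw := ν
  input := Measure.pi fun t => complexGaussian (if t.val < B * K then P.toNNReal else 0)
  listens _ _ k t _ := !decide (0 < t ∧ (t - 1) % K = k.val)
  send H s k t past :=
    if h : 0 < t then
      (amplification G P H k : ℂ) * Complex.exp (2 * Real.pi * Complex.I * s (t - 1)) *
        past ⟨t - 1, Nat.sub_lt h Nat.one_pos⟩
    else 0

end RelayNet

end

/-!
A scheme is bounded from above through the cut between the relays and the receiver, and the random
sequential scheme is bounded from below path by path; both bounds have exponents of the form
`P ^ (-d)`, and they meet as `B → ∞`.

**Converse.** Given the channel and the seed, the receiver observes a signal in which only the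
relays appear, plus Gaussian noise. The divergence of the joint law of input and output from the
product of its marginals is at most its divergence from the product of the input law with a white
Gaussian law of variance `1 + K P ∑ k, |h k|²`, where `h k` is the gain from relay `k` to the
receiver, and by the power constraint this is at most `n log (1 + K P ∑ k, |h k|²)`
(`Scheme.mutualInfo_le`). The event `|h k|² ≤ P ^ (-max 0 (1 - r)) / (2 K²)` for all `k` forces an
outage, and it has probability of order `P ^ (-K max 0 (1 - r))` because complex Gaussian densities
are bounded below near the origin (`exists_le_outage`).

**Power of the scheme.** The symbols and the noises are independent and symmetric under sign flips.
Flipping the signs of what is new in a slot and averaging with the parallelogram law shows that the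
second moments of the new and of the old part add (`lintegral_enorm_add_sq_of_flip`). The
amplification factor is chosen so that this recursion keeps the transmitted power below `P`
(`admissible_rs`).

**Lower bound on the mutual information.** The listening relay transmits in the next slot what it
received, so the output in slot `i + 1` is a function of earlier quantities plus
`downGain i * upGain i * x i`: the channel is triangular. The variational inequality
`∫ log f ∂μ - log ∫ f ∂ν ≤ klDiv μ ν` (`ofReal_integral_sub_log_le_klDiv`) is applied to a product
of Gaussian functions of the effective noises. Under the joint law the integral of `log f` is
bounded. Under the product of the marginals, integrating the symbols one at a time bounds the
integral of `f` by a product, since the Gaussian density is bounded (`lintegral_prod_exp_le`). This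
gives `I ≥ ∑ i, log (P |upGain i|² |downGain i|²)` up to a constant and the logarithm of a
polynomial in the gains (`mutualInfo_rs_ge_sum_log`), with no determinant to compute.

**Outage of the scheme.** Outage at the gain `r` thus gives
`P ^ (K (1 - r) - r / B) ≤ C(H) ∏ j, |h j|⁻²`, the product running over the `2 K` hops, with `C(H)`
polynomial in the gains (`rpow_le_of_outage`). Since `|h|⁻²` has a finite moment of every order
`θ < 1` under a complex Gaussian law, Markov's inequality bounds the outage probability by a
constant times `P ^ (-θ (K (1 - r) - r / B))` (`exists_outage_rs_le`), and `θ` tends to `1`.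
-/

namespace RelayNet

open InformationTheory

/-! ### The complex Gaussian law -/

lemma measurable_complexMk : Measurable fun p : ℝ × ℝ => (⟨p.1, p.2⟩ : ℂ) :=
  Complex.measurableEquivRealProd.symm.measurable

instance isProbabilityMeasure_complexGaussian (v : ℝ≥0) :
    IsProbabilityMeasure (complexGaussian v) :=
  Measure.isProbabilityMeasure_map measurable_complexMk.aemeasurable

lemma complexGaussian_zero : complexGaussian 0 = Measure.dirac 0 := by
  rw [complexGaussian, zero_div, gaussianReal_zero_var, Measure.dirac_prod_dirac,
    Measure.map_dirac' measurable_complexMk]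
  rfl

/-- The density of `𝒞𝒩(0, v)` with respect to the Lebesgue measure on `ℂ`. -/
noncomputable def cnDensity (v : ℝ≥0) (z : ℂ) : ℝ≥0∞ :=
  ENNReal.ofReal ((Real.pi * v)⁻¹ * Real.exp (-‖z‖ ^ 2 / v))

lemma measurable_cnDensity (v : ℝ≥0) : Measurable (cnDensity v) := by
  unfold cnDensity; fun_prop

lemma complexGaussian_eq_withDensity {v : ℝ≥0} (hv : v ≠ 0) :
    complexGaussian v = volume.withDensity (cnDensity v) := by
  have hv2 : v / 2 ≠ 0 := by positivity
  ext s hs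
  rw [complexGaussian, gaussianReal_of_var_ne_zero _ hv2,
    prod_withDensity (measurable_gaussianPDF _ _) (measurable_gaussianPDF _ _),
    Measure.map_apply measurable_complexMk hs,
    withDensity_apply _ (measurable_complexMk hs), withDensity_apply _ hs,
    ← Complex.volume_preserving_equiv_real_prod.symm.setLIntegral_comp_preimage_emb
      Complex.measurableEquivRealProd.symm.measurableEmbedding]
  refine lintegral_congr fun p => ?_
  rw [gaussianPDF_def, cnDensity, ← ENNReal.ofReal_mul (gaussianPDFReal_nonneg _ _ _)]
  congr 1
  have hn : ‖Complex.measurableEquivRealProd.symm p‖ ^ 2 = p.1 ^ 2 + p.2 ^ 2 := by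
    rw [← Complex.normSq_eq_norm_sq, Complex.normSq_apply]
    simp [Complex.measurableEquivRealProd, sq]
  rw [hn, gaussianPDFReal, gaussianPDFReal]
  have h1 : (2 * Real.pi * ((v / 2 : ℝ≥0) : ℝ)) = Real.pi * v := by push_cast; ring
  have h2 : (2 * ((v / 2 : ℝ≥0) : ℝ)) = v := by push_cast; ring
  rw [h1, h2, mul_mul_mul_comm, ← mul_inv, Real.mul_self_sqrt (by positivity), ← Real.exp_add]
  congr 2
  ring

lemma lintegral_cnDensity {v : ℝ≥0} (hv : v ≠ 0) : ∫⁻ z, cnDensity v z = 1 := by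
  have := measure_univ (μ := complexGaussian v)
  rwa [complexGaussian_eq_withDensity hv, withDensity_apply _ MeasurableSet.univ,
    setLIntegral_univ] at this

lemma lintegral_enorm_sq_complexGaussian (v : ℝ≥0) :
    ∫⁻ z, ‖z‖ₑ ^ 2 ∂complexGaussian v = v := by
  have hr : ∫⁻ x, ENNReal.ofReal (x ^ 2) ∂gaussianReal 0 (v / 2) = (v / 2 : ℝ≥0) := by
    have h := evariance_eq_lintegral_ofReal id (gaussianReal 0 (v / 2))
    simp only [id, integral_id_gaussianReal, sub_zero] at h
    rw [← h]
    have hm : MemLp id 2 (gaussianReal 0 (v / 2)) := memLp_id_gaussianReal 2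
    change eVar[id; gaussianReal 0 (v / 2)] = _
    rw [← hm.ofReal_variance_eq, variance_id_gaussianReal, ENNReal.ofReal_coe_nnreal]
  have hm : Measurable fun x : ℝ => ENNReal.ofReal (x ^ 2) := by fun_prop
  rw [complexGaussian, lintegral_map (by fun_prop) measurable_complexMk]
  have : ∀ p : ℝ × ℝ, ‖(⟨p.1, p.2⟩ : ℂ)‖ₑ ^ 2
      = ENNReal.ofReal (p.1 ^ 2) + ENNReal.ofReal (p.2 ^ 2) := fun p => by
    rw [← ofReal_norm, ← ENNReal.ofReal_pow (norm_nonneg _), ← Complex.normSq_eq_norm_sq,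
      Complex.normSq_apply, ← ENNReal.ofReal_add (sq_nonneg _) (sq_nonneg _)]
    simp [sq]
  simp_rw [this]
  rw [lintegral_add_left (by fun_prop), lintegral_prod _ (by fun_prop),
    lintegral_prod _ (by fun_prop)]
  simp only [lintegral_const, measure_univ, mul_one, hr]
  rw [← ENNReal.coe_add, add_halves]

lemma measurePreserving_neg_complexGaussian (v : ℝ≥0) :
    MeasurePreserving (fun z : ℂ => -z) (complexGaussian v) (complexGaussian v) := by
  refine ⟨measurable_neg, ?_⟩
  have hg : MeasurePreserving (fun x : ℝ => -x) (gaussianReal 0 (v / 2)) (gaussianReal 0 (v / 2)) :=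
    ⟨measurable_neg, by rw [gaussianReal_map_neg, neg_zero]⟩
  rw [complexGaussian, Measure.map_map measurable_neg measurable_complexMk]
  conv_rhs => rw [← (hg.prod hg).map_eq,
    Measure.map_map measurable_complexMk (hg.prod hg).measurable]
  congr 1

lemma complexGaussian_singleton_zero {v : ℝ≥0} (hv : v ≠ 0) : complexGaussian v {0} = 0 := by
  rw [complexGaussian_eq_withDensity hv]
  exact withDensity_absolutelyContinuous _ _ (measure_singleton 0)

/-- Since `𝒞𝒩(0, v)` has a density at most `1 / (π v)`, a Gaussian bump of width `b` around a
point that moves with slope `a` has mean at most `b / (v |a|²)`. -/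
lemma lintegral_exp_affine_le {v : ℝ≥0} (hv : v ≠ 0) {a : ℂ} (ha : a ≠ 0) (c : ℂ) {b : ℝ}
    (hb : 0 < b) :
    ∫⁻ z, ENNReal.ofReal (Real.exp (-‖a * z + c‖ ^ 2 / b)) ∂complexGaussian v
      ≤ ENNReal.ofReal (b / (v * ‖a‖ ^ 2)) := by
  set w : ℝ≥0 := ⟨b / ‖a‖ ^ 2, by positivity⟩ with hw
  have hwv : (w : ℝ) = b / ‖a‖ ^ 2 := rfl
  have hw0 : w ≠ 0 := by
    intro h
    have : (w : ℝ) = 0 := by rw [h]; rfl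
    rw [hwv] at this
    exact absurd this (by positivity)
  have hle : ∀ z, cnDensity v z * ENNReal.ofReal (Real.exp (-‖a * z + c‖ ^ 2 / b))
      ≤ ENNReal.ofReal (b / (v * ‖a‖ ^ 2)) * cnDensity w (z + c / a) := fun z => by
    rw [cnDensity, cnDensity, ← ENNReal.ofReal_mul (by positivity),
      ← ENNReal.ofReal_mul (by positivity)]
    apply ENNReal.ofReal_le_ofReal
    have h1 : ‖a * z + c‖ ^ 2 = ‖a‖ ^ 2 * ‖z + c / a‖ ^ 2 := by
      rw [← mul_pow, ← norm_mul, mul_add, mul_div_cancel₀ _ ha]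
    have h2 : -‖a * z + c‖ ^ 2 / b = -‖z + c / a‖ ^ 2 / (w : ℝ) := by
      rw [h1, hwv]; field_simp
    have h3 : Real.exp (-‖z‖ ^ 2 / (v : ℝ)) ≤ 1 := by
      rw [Real.exp_le_one_iff, neg_div]
      exact neg_nonpos.2 (by positivity)
    rw [h2, hwv]
    calc (Real.pi * (v : ℝ))⁻¹ * Real.exp (-‖z‖ ^ 2 / (v : ℝ)) * _
        ≤ (Real.pi * (v : ℝ))⁻¹ * 1 * Real.exp (-‖z + c / a‖ ^ 2 / (b / ‖a‖ ^ 2)) := by gcongr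
      _ = _ := by field_simp
  rw [complexGaussian_eq_withDensity hv,
    lintegral_withDensity_eq_lintegral_mul _ (measurable_cnDensity v) (by fun_prop)]
  calc _ ≤ ∫⁻ z, ENNReal.ofReal (b / (v * ‖a‖ ^ 2)) * cnDensity w (z + c / a) :=
        lintegral_mono hle
    _ = ENNReal.ofReal (b / (v * ‖a‖ ^ 2)) := by
        have hm := measurable_cnDensity w
        rw [lintegral_const_mul _ (by fun_prop), lintegral_add_right_eq_self (cnDensity w),
          lintegral_cnDensity hw0, mul_one]

lemma exists_le_complexGaussian_ball {v : ℝ≥0} (hv : v ≠ 0) :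
    ∃ c : ℝ, 0 < c ∧ ∀ δ : ℝ, 0 ≤ δ → δ ≤ 1 →
      ENNReal.ofReal (c * δ) ≤ complexGaussian v {z | ‖z‖ ^ 2 ≤ δ} := by
  refine ⟨(v : ℝ)⁻¹ * Real.exp (-1 / v), by positivity, fun δ h0 h1 => ?_⟩
  have hs : {z : ℂ | ‖z‖ ^ 2 ≤ δ} = Metric.closedBall 0 (√δ) := by
    ext z
    rw [Set.mem_ofPred_eq, mem_closedBall_zero_iff, Real.le_sqrt (norm_nonneg _) h0]
  have hms : MeasurableSet {z : ℂ | ‖z‖ ^ 2 ≤ δ} := by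
    rw [hs]; exact Metric.isClosed_closedBall.measurableSet
  rw [complexGaussian_eq_withDensity hv, withDensity_apply _ hms]
  calc ENNReal.ofReal ((v : ℝ)⁻¹ * Real.exp (-1 / v) * δ)
      = ENNReal.ofReal ((Real.pi * v)⁻¹ * Real.exp (-1 / v)) * volume {z : ℂ | ‖z‖ ^ 2 ≤ δ} := by
        rw [hs, Complex.volume_closedBall, ← ENNReal.ofReal_pow (Real.sqrt_nonneg _),
          Real.sq_sqrt h0, ← ENNReal.ofReal_coe_nnreal, ← ENNReal.ofReal_mul h0,
          ← ENNReal.ofReal_mul (by positivity), NNReal.coe_real_pi]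
        congr 1
        field_simp
    _ = ∫⁻ _ in {z : ℂ | ‖z‖ ^ 2 ≤ δ}, ENNReal.ofReal ((Real.pi * v)⁻¹ * Real.exp (-1 / v)) := by
        rw [setLIntegral_const]
    _ ≤ _ := setLIntegral_mono (measurable_cnDensity v) fun z hz => by
        have hz : ‖z‖ ^ 2 ≤ δ := hz
        unfold cnDensity
        apply ENNReal.ofReal_le_ofReal
        gcongr
        linarith

lemma integrable_norm_rpow_mul_exp {v q : ℝ} (hv : 0 < v) (hq : -2 < q) :
    Integrable fun z : ℂ => ‖z‖ ^ q * Real.exp (-v * ‖z‖ ^ (2 : ℝ)) := by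
  refine Integrable.of_integral_ne_zero ?_
  rw [Complex.integral_rpow_mul_exp_neg_mul_rpow (by norm_num) hq hv]
  have := Real.Gamma_pos_of_pos (s := (q + 2) / 2) (by linarith)
  positivity

/-- Negative moments `E |z|^(-2θ)` of a complex Gaussian are finite for `θ < 1`, and a polynomial
factor does no harm. -/
lemma lintegral_moment_lt_top {v : ℝ≥0} (hv : v ≠ 0) (N : ℕ) {θ : ℝ} (hθ : θ < 1) :
    ∫⁻ z, ENNReal.ofReal ((1 + ‖z‖ ^ 2) ^ N * (‖z‖ ^ 2) ^ (-θ)) ∂complexGaussian v < ⊤ := by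
  have hv0 : (0 : ℝ) < v := by positivity
  rw [complexGaussian_eq_withDensity hv,
    lintegral_withDensity_eq_lintegral_mul _ (measurable_cnDensity v) (by fun_prop)]
  have hi := ((integrable_norm_rpow_mul_exp (q := -2 * θ) (inv_pos.2 hv0) (by linarith)).add
    (integrable_norm_rpow_mul_exp (q := 2 * N + -2 * θ) (inv_pos.2 hv0) (by
      have : (0 : ℝ) ≤ N := by positivity
      linarith))).const_mul ((Real.pi * v)⁻¹ * 2 ^ (N - 1))
  refine lt_of_le_of_lt (lintegral_mono_ae ?_) hi.lintegral_lt_top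
  have h0 : ∀ᵐ z : ℂ, z ≠ 0 := by simp [ae_iff]
  filter_upwards [h0] with z hz
  have hz0 : 0 < ‖z‖ := norm_pos_iff.2 hz
  rw [Pi.mul_apply, cnDensity, ← ENNReal.ofReal_mul (by positivity)]
  apply ENNReal.ofReal_le_ofReal
  have e1 : (‖z‖ ^ 2) ^ (-θ) = ‖z‖ ^ (-2 * θ) := by
    rw [← Real.rpow_natCast, ← Real.rpow_mul hz0.le]; congr 1; push_cast; ring
  have e2 : ‖z‖ ^ (2 * N + -2 * θ) = (‖z‖ ^ 2) ^ N * ‖z‖ ^ (-2 * θ) := by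
    rw [Real.rpow_add hz0, ← pow_mul, ← Real.rpow_natCast]; congr 2; push_cast; ring
  have e3 : -‖z‖ ^ 2 / (v : ℝ) = -(v : ℝ)⁻¹ * ‖z‖ ^ (2 : ℝ) := by
    rw [Real.rpow_two]; field_simp
  simp only [Pi.add_apply]
  rw [e1, e2, e3]
  have h4 := add_pow_le (zero_le_one' ℝ) (sq_nonneg ‖z‖) N
  rw [one_pow] at h4
  set E := Real.exp (-(v : ℝ)⁻¹ * ‖z‖ ^ (2 : ℝ))
  set R := ‖z‖ ^ (-2 * θ)
  calc _ = (Real.pi * v)⁻¹ * E * R * (1 + ‖z‖ ^ 2) ^ N := by ring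
    _ ≤ (Real.pi * v)⁻¹ * E * R * (2 ^ (N - 1) * (1 + (‖z‖ ^ 2) ^ N)) := by gcongr
    _ = _ := by ring

lemma lintegral_one_add_norm_sq_pow_lt_top (v : ℝ≥0) (N : ℕ) :
    ∫⁻ z, ENNReal.ofReal ((1 + ‖z‖ ^ 2) ^ N) ∂complexGaussian v < ⊤ := by
  rcases eq_or_ne v 0 with rfl | hv
  · rw [complexGaussian_zero, lintegral_dirac]
    exact ENNReal.ofReal_lt_top
  · simpa using lintegral_moment_lt_top hv N (θ := 0) (by norm_num)

/-! ### Integrals over finite products -/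

lemma lintegral_pi_prod {ι α : Type*} [Fintype ι] [MeasurableSpace α] (μ : ι → Measure α)
    [∀ i, IsProbabilityMeasure (μ i)] (f : ι → α → ℝ≥0∞) (hf : ∀ i, Measurable (f i)) :
    ∫⁻ x, ∏ i, f i (x i) ∂Measure.pi μ = ∏ i, ∫⁻ z, f i z ∂μ i := by
  have h := iIndepFun_pi (μ := μ) (X := f) fun i => (hf i).aemeasurable
  rw [lintegral_prod_eq_prod_lintegral_of_indepFun Finset.univ _ h
    fun i => (hf i).comp (measurable_pi_apply i)]
  refine Finset.prod_congr rfl fun i _ => ?_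
  exact (measurePreserving_eval μ i).lintegral_comp (hf i)

/-- Integration of a product whose `i`-th factor depends on the coordinates up to `i` only: if the
`i`-th factor has integral at most `C i` in its own coordinate, whatever the previous ones, then
the integral of the product is at most `∏ C i`. -/
lemma lintegral_pi_prod_le {α : Type*} [MeasurableSpace α] (n : ℕ) (μ : ℕ → Measure α)
    [∀ i, IsProbabilityMeasure (μ i)] (F : (i : ℕ) → (Fin i → α) → α → ℝ≥0∞)
    (hF : ∀ i, Measurable fun p : (Fin i → α) × α => F i p.1 p.2)
    (C : ℕ → ℝ≥0∞) (hC : ∀ i < n, ∀ p, ∫⁻ z, F i p z ∂μ i ≤ C i) :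
    ∫⁻ x, ∏ i : Fin n, F i (fun j => x ⟨j, j.2.trans i.2⟩) (x i)
      ∂Measure.pi (fun i : Fin n => μ i) ≤ ∏ i : Fin n, C i := by
  induction n with
  | zero => simp
  | succ n ih =>
    have hmp := (measurePreserving_piFinSuccAbove (fun i : Fin (n + 1) => μ i) (Fin.last n)).symm
    rw [← hmp.lintegral_comp_emb (MeasurableEquiv.measurableEmbedding _)]
    simp only [Fin.prod_univ_castSucc, Fin.val_castSucc, Fin.val_last,
      MeasurableEquiv.piFinSuccAbove_symm_apply, Fin.insertNthEquiv_last]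
    have hlast : ∀ p : α × (Fin n → α), Fin.snoc (α := fun _ => α) p.2 p.1 (Fin.last n) = p.1 :=
      fun p => Fin.snoc_last _ _
    have hcast : ∀ (p : α × (Fin n → α)) (j : ℕ) (hj : j < n) (hj' : j < n + 1),
      Fin.snoc (α := fun _ => α) p.2 p.1 ⟨j, hj'⟩ = p.2 ⟨j, hj⟩ := fun p j hj hj' => by
        exact Fin.snoc_castSucc (α := fun _ => α) p.1 p.2 ⟨j, hj⟩
    have hcast' : ∀ (p : α × (Fin n → α)) (j : Fin n),
      Fin.snoc (α := fun _ => α) p.2 p.1 j.castSucc = p.2 j := fun p j => by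
        exact Fin.snoc_castSucc (α := fun _ => α) p.1 p.2 j
    have heq : ∀ p : α × (Fin n → α),
        (∏ i : Fin n, F i (fun j => (Fin.snocEquiv fun _ => α) p ⟨j, by omega⟩)
          ((Fin.snocEquiv fun _ => α) p i.castSucc)) *
          F n (fun j => (Fin.snocEquiv fun _ => α) p ⟨j, by omega⟩)
            ((Fin.snocEquiv fun _ => α) p (Fin.last n)) =
        (∏ i : Fin n, F i (fun j => p.2 ⟨j, j.2.trans i.2⟩) (p.2 i)) * F n p.2 p.1 := fun p => by
      simp only [Fin.snocEquiv_apply, hlast, hcast']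
      congr 1
      · refine Finset.prod_congr rfl fun i _ => ?_
        congr 1
        funext j
        exact hcast p j (j.2.trans i.2) _
      · congr 1
        funext j
        exact hcast p j j.2 _
    have hm : Measurable fun y : Fin n → α =>
        ∏ i : Fin n, F i (fun j => y ⟨j, j.2.trans i.2⟩) (y i) := by
      refine Finset.measurable_prod _ fun i _ => ?_
      exact (hF i).comp (f := fun y : Fin n → α =>
        ((fun j : Fin i => y ⟨j, j.2.trans i.2⟩), y i)) (by fun_prop)
    have hm' : Measurable fun p : α × (Fin n → α) => F n p.2 p.1 := (hF n).comp measurable_swap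
    simp_rw [heq]
    simp only [Fin.succAbove_last, Fin.val_castSucc]
    have hmm : Measurable fun p : α × (Fin n → α) =>
        (∏ i : Fin n, F i (fun j => p.2 ⟨j, j.2.trans i.2⟩) (p.2 i)) * F n p.2 p.1 :=
      (hm.comp measurable_snd).mul hm'
    rw [lintegral_prod_symm _ hmm.aemeasurable]
    calc _ ≤ ∫⁻ y : Fin n → α, (∏ i : Fin n, F i (fun j => y ⟨j, j.2.trans i.2⟩) (y i)) * C n
          ∂Measure.pi (fun i : Fin n => μ i) := lintegral_mono fun y => by
            dsimp only
            have hy : Measurable fun z => F n y z :=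
              hm'.comp (measurable_id.prodMk measurable_const)
            rw [lintegral_const_mul _ hy]
            gcongr
            exact hC n (Nat.lt_succ_self n) y
      _ ≤ _ := by
            rw [lintegral_mul_const _ hm]
            gcongr
            exact ih fun i hi => hC i (Nat.lt_succ_of_lt hi)

lemma enorm_sq_eq_ofReal (z : ℂ) : ‖z‖ₑ ^ 2 = ENNReal.ofReal (‖z‖ ^ 2) := by
  rw [← ofReal_norm, ENNReal.ofReal_pow (norm_nonneg _)]

/-- The parallelogram law turns sign symmetry into orthogonality: if a measure preserving map
leaves `a` unchanged and changes the sign of `b`, then the cross terms of `‖a + b‖²` cancel. -/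
lemma lintegral_enorm_add_sq_of_flip {Ω : Type*} [MeasurableSpace Ω] {μ : Measure Ω} {T : Ω → Ω}
    (hT : MeasurePreserving T μ μ) {a b : Ω → ℂ} (ha : Measurable a) (hb : Measurable b)
    (haT : ∀ ω, a (T ω) = a ω) (hbT : ∀ ω, b (T ω) = -b ω) :
    ∫⁻ ω, ‖a ω + b ω‖ₑ ^ 2 ∂μ = ∫⁻ ω, ‖a ω‖ₑ ^ 2 ∂μ + ∫⁻ ω, ‖b ω‖ₑ ^ 2 ∂μ := by
  have h1 : ∫⁻ ω, ‖a ω - b ω‖ₑ ^ 2 ∂μ = ∫⁻ ω, ‖a ω + b ω‖ₑ ^ 2 ∂μ := by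
    rw [← hT.lintegral_comp (f := fun ω => ‖a ω + b ω‖ₑ ^ 2) (by fun_prop)]
    simp_rw [haT, hbT, sub_eq_add_neg]
  have h2 : ∀ z w : ℂ, ‖z + w‖ₑ ^ 2 + ‖z - w‖ₑ ^ 2 = 2 * (‖z‖ₑ ^ 2 + ‖w‖ₑ ^ 2) := fun z w => by
    have h2 : (2 : ℝ≥0∞) = ENNReal.ofReal 2 := by simp
    simp only [enorm_sq_eq_ofReal]
    rw [h2, ← ENNReal.ofReal_add (by positivity) (by positivity),
      ← ENNReal.ofReal_add (by positivity) (by positivity), ← ENNReal.ofReal_mul (by positivity)]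
    congr 1
    have := parallelogram_law_with_norm ℝ z w
    linarith
  have h3 : ∫⁻ ω, ‖a ω + b ω‖ₑ ^ 2 ∂μ + ∫⁻ ω, ‖a ω - b ω‖ₑ ^ 2 ∂μ
      = 2 * (∫⁻ ω, ‖a ω‖ₑ ^ 2 ∂μ + ∫⁻ ω, ‖b ω‖ₑ ^ 2 ∂μ) := by
    rw [← lintegral_add_left (by fun_prop), ← lintegral_add_left (by fun_prop),
      ← lintegral_const_mul _ (by fun_prop)]
    simp_rw [h2]
  rw [h1, ← two_mul] at h3
  exact (ENNReal.mul_right_inj (by simp) (by simp)).1 h3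

/-! ### Bounds on the Kullback-Leibler divergence -/

/-- One half of the Donsker-Varadhan formula: every test function `f` bounds the divergence
from below by `∫ f ∂μ - log ∫ exp f ∂ν`. -/
lemma ofReal_integral_sub_log_le_klDiv {α : Type*} [MeasurableSpace α] (μ ν : Measure α)
    [IsProbabilityMeasure μ] [IsProbabilityMeasure ν] {f : α → ℝ} (hf : Measurable f)
    (hfμ : Integrable f μ) {C : ℝ} (hC : 0 < C)
    (hfν : ∫⁻ x, ENNReal.ofReal (Real.exp (f x)) ∂ν ≤ ENNReal.ofReal C) :
    ENNReal.ofReal (∫ x, f x ∂μ - Real.log C) ≤ klDiv μ ν := by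
  by_cases h : μ ≪ ν ∧ Integrable (llr μ ν) μ
  swap
  · rw [klDiv_def, if_neg h]
    exact le_top
  obtain ⟨hac, hint⟩ := h
  have hexp : Integrable (fun x => Real.exp (f x)) ν := by
    refine ⟨by fun_prop, ?_⟩
    rw [hasFiniteIntegral_iff_ofReal (ae_of_all _ fun x => (Real.exp_pos _).le)]
    exact hfν.trans_lt ENNReal.ofReal_lt_top
  have hpos : 0 < ∫ x, Real.exp (f x) ∂ν := integral_exp_pos hexp
  have hle : ∫ x, Real.exp (f x) ∂ν ≤ C := by
    rw [integral_eq_lintegral_of_nonneg_ae (ae_of_all _ fun x => (Real.exp_pos _).le)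
      hexp.aestronglyMeasurable]
    exact ENNReal.toReal_le_of_le_ofReal hC.le hfν
  have := isProbabilityMeasure_tilted hexp
  have hnn := integral_llr_add_sub_measure_univ_nonneg
    (hac.trans (absolutelyContinuous_tilted hexp))
    (integrable_llr_tilted_right hac hfμ hint hexp)
  rw [integral_llr_tilted_right hac hfμ hexp hint] at hnn
  simp only [probReal_univ, add_sub_cancel_right] at hnn
  rw [klDiv_of_ac_of_integrable hac hint]
  simp only [probReal_univ, add_sub_cancel_right]
  apply ENNReal.ofReal_le_ofReal
  have := Real.log_le_log hpos hle
  linarith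

/-- The divergence to a product measure whose first factor is the first marginal is smallest
when the second factor is the second marginal. -/
lemma klDiv_fst_prod_snd_le {α β : Type*} [MeasurableSpace α] [MeasurableSpace β]
    [StandardBorelSpace α] [Nonempty α] (μ : Measure (α × β)) [IsProbabilityMeasure μ]
    (Q : Measure β) [IsProbabilityMeasure Q] :
    klDiv μ (μ.fst.prod μ.snd) ≤ klDiv μ (μ.fst.prod Q) := by
  set ρ := μ.map Prod.swap with hρ
  have hfst : ρ.fst = μ.snd := Measure.fst_map_swap
  have hswap : ρ.map Prod.swap = μ := by
    rw [hρ, Measure.map_map measurable_swap measurable_swap, Prod.swap_swap_eq, Measure.map_id]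
  have h := klDiv_compProd_eq_add ρ.fst Q ρ.condKernel (Kernel.const β μ.fst)
  rw [ρ.disintegrate, Measure.compProd_const, Measure.compProd_const, hfst] at h
  calc klDiv μ (μ.fst.prod μ.snd)
      = klDiv (ρ.map Prod.swap) ((μ.snd.prod μ.fst).map Prod.swap) := by
        rw [Measure.prod_swap, hswap]
    _ ≤ klDiv ρ (μ.snd.prod μ.fst) := klDiv_map_le _ _ measurable_swap
    _ ≤ klDiv ρ (Q.prod μ.fst) := h ▸ le_add_self
    _ = klDiv (μ.map Prod.swap) ((μ.fst.prod Q).map Prod.swap) := by rw [Measure.prod_swap]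
    _ ≤ klDiv μ (μ.fst.prod Q) := klDiv_map_le _ _ measurable_swap

/-! ### The Gaussian channel -/

/-- The exponent of the density of `𝒞𝒩(a, I)` with respect to `𝒞𝒩(0, s I)`. -/
noncomputable def gaussianLLR {n : ℕ} (s : ℝ≥0) (a y : Fin n → ℂ) : ℝ :=
  ∑ t, (Real.log s + (‖y t‖ ^ 2 / s - ‖y t - a t‖ ^ 2))

lemma map_add_complexGaussian_one {s : ℝ≥0} (hs : s ≠ 0) (a : ℂ) :
    (complexGaussian 1).map (fun z => a + z) = (complexGaussian s).withDensity
      fun y => ENNReal.ofReal (Real.exp (Real.log s + (‖y‖ ^ 2 / s - ‖y - a‖ ^ 2))) := by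
  have hs0 : (0 : ℝ) < s := by positivity
  have hmp : MeasurePreserving (fun z : ℂ => a + z) volume volume := measurePreserving_add_left _ a
  rw [complexGaussian_eq_withDensity hs, complexGaussian_eq_withDensity one_ne_zero,
    ← withDensity_mul _ (measurable_cnDensity s) (by fun_prop)]
  ext S hS
  rw [Measure.map_apply (by fun_prop) hS, withDensity_apply _ hS,
    withDensity_apply _ (hmp.measurable hS)]
  conv_rhs =>
    rw [← hmp.setLIntegral_comp_preimage_emb (MeasurableEquiv.addLeft a).measurableEmbedding]
  refine lintegral_congr fun z => ?_
  rw [Pi.mul_apply, cnDensity, cnDensity, ← ENNReal.ofReal_mul (by positivity)]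
  congr 1
  rw [Real.exp_add, Real.exp_sub, Real.exp_log hs0, add_sub_cancel_left, NNReal.coe_one, div_one,
    mul_one, neg_div, Real.exp_neg, Real.exp_neg]
  field_simp

lemma pi_withDensity {ι α : Type*} [Fintype ι] [MeasurableSpace α] (μ : ι → Measure α)
    [∀ i, IsProbabilityMeasure (μ i)] (f : ι → α → ℝ≥0∞) (hf : ∀ i, Measurable (f i))
    [∀ i, SigmaFinite ((μ i).withDensity (f i))] :
    Measure.pi (fun i => (μ i).withDensity (f i))
      = (Measure.pi μ).withDensity fun x => ∏ i, f i (x i) := by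
  refine Measure.pi_eq fun S hS => ?_
  have hf' : ∀ i, Measurable ((S i).indicator (f i)) := fun i => (hf i).indicator (hS i)
  rw [withDensity_apply _ (MeasurableSet.univ_pi hS),
    ← lintegral_indicator (MeasurableSet.univ_pi hS)]
  calc _ = ∫⁻ x, ∏ i, (S i).indicator (f i) (x i) ∂Measure.pi μ := by
        refine lintegral_congr fun x => ?_
        by_cases hx : x ∈ Set.univ.pi S
        · rw [Set.indicator_of_mem hx]
          exact Finset.prod_congr rfl fun i _ => (Set.indicator_of_mem (hx i trivial) _).symm
        · rw [Set.indicator_of_notMem hx]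
          obtain ⟨i, hi⟩ : ∃ i, x i ∉ S i := by simpa using hx
          exact (Finset.prod_eq_zero (Finset.mem_univ i) (Set.indicator_of_notMem hi _)).symm
    _ = _ := by
        rw [lintegral_pi_prod μ _ hf']
        refine Finset.prod_congr rfl fun i _ => ?_
        rw [lintegral_indicator (hS i), withDensity_apply _ (hS i)]

lemma map_add_pi_complexGaussian_one {n : ℕ} {s : ℝ≥0} (hs : s ≠ 0) (a : Fin n → ℂ) :
    (Measure.pi fun _ : Fin n => complexGaussian 1).map (fun w => a + w)
      = (Measure.pi fun _ : Fin n => complexGaussian s).withDensity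
        fun y => ENNReal.ofReal (Real.exp (gaussianLLR s a y)) := by
  have h := fun t => map_add_complexGaussian_one hs (a t)
  have hp : ∀ t, IsProbabilityMeasure ((complexGaussian 1).map (fun z => a t + z)) := fun t =>
    Measure.isProbabilityMeasure_map (by fun_prop)
  have h1 := (measurePreserving_pi (fun _ : Fin n => complexGaussian 1)
    (fun t => (complexGaussian 1).map (fun z => a t + z))
    (fun t => ⟨by fun_prop, rfl⟩)).map_eq
  have hp' := hp
  simp_rw [h] at h1 hp'
  rw [pi_withDensity _ _ (fun t => by fun_prop)] at h1
  refine Eq.trans h1 ?_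
  congr 1
  funext y
  rw [gaussianLLR, Real.exp_sum, ENNReal.ofReal_prod_of_nonneg fun _ _ => (Real.exp_pos _).le]

/-- A Gaussian channel `y = m(ω) + n` with `E|m|² ≤ n τ`: the divergence of the joint law from the
product of the law of `ω` and of `𝒞𝒩(0, (1 + τ) I)` is at most `n log (1 + τ)`. -/
lemma klDiv_gaussianChannel_le {Ω : Type*} [MeasurableSpace Ω] (Λ : Measure Ω)
    [IsProbabilityMeasure Λ] {n : ℕ} {m : Ω → Fin n → ℂ} (hm : Measurable m) (τ : ℝ≥0)
    (hpow : ∫⁻ ω, ∑ t, ‖m ω t‖ₑ ^ 2 ∂Λ ≤ n * τ) :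
    klDiv ((Λ.prod (Measure.pi fun _ : Fin n => complexGaussian 1)).map
        fun p => (p.1, m p.1 + p.2))
      (Λ.prod (Measure.pi fun _ : Fin n => complexGaussian (1 + τ)))
      ≤ ENNReal.ofReal (n * Real.log (1 + τ)) := by
  set γ := Measure.pi fun _ : Fin n => complexGaussian 1 with hγ
  set Q := Measure.pi fun _ : Fin n => complexGaussian (1 + τ) with hQ
  have hs : (1 + τ) ≠ 0 := by positivity
  have hmm : Measurable fun p : Ω × (Fin n → ℂ) => (p.1, m p.1 + p.2) := by fun_prop
  have hg : Measurable fun p : Ω × (Fin n → ℂ) => gaussianLLR (1 + τ) (m p.1) p.2 := by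
    unfold gaussianLLR; fun_prop
  have hge : Measurable fun p : Ω × (Fin n → ℂ) =>
      ENNReal.ofReal (Real.exp (gaussianLLR (1 + τ) (m p.1) p.2)) := by fun_prop
  set ρ := (Λ.prod γ).map fun p => (p.1, m p.1 + p.2) with hρ
  have hρp : IsProbabilityMeasure ρ := Measure.isProbabilityMeasure_map hmm.aemeasurable
  have hden : ρ = (Λ.prod Q).withDensity
      fun p => ENNReal.ofReal (Real.exp (gaussianLLR (1 + τ) (m p.1) p.2)) := by
    ext S hS
    rw [hρ, Measure.map_apply hmm hS, Measure.prod_apply (hmm hS), withDensity_apply _ hS,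
      ← lintegral_indicator hS, lintegral_prod _ (hge.indicator hS).aemeasurable]
    refine lintegral_congr fun ω => ?_
    have hSω : MeasurableSet (Prod.mk ω ⁻¹' S) := measurable_prodMk_left hS
    have h1 := congrArg (fun ν => ν (Prod.mk ω ⁻¹' S)) (map_add_pi_complexGaussian_one hs (m ω))
    rw [Measure.map_apply (by fun_prop) hSω, withDensity_apply _ hSω,
      ← lintegral_indicator hSω] at h1
    exact h1
  have hac : ρ ≪ Λ.prod Q := hden ▸ withDensity_absolutelyContinuous _ _
  have hllr : llr ρ (Λ.prod Q) =ᵐ[ρ] fun p => gaussianLLR (1 + τ) (m p.1) p.2 := by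
    refine hac.ae_le ?_
    have h1 := Measure.rnDeriv_withDensity (Λ.prod Q) hge
    rw [← hden] at h1
    filter_upwards [h1] with p hp
    rw [llr_def]
    simp only
    rw [hp, ENNReal.toReal_ofReal (Real.exp_pos _).le, Real.log_exp]
  -- the second moments of signal, noise and received signal
  have hEm : ∀ t, ∫⁻ ω, ‖m ω t‖ₑ ^ 2 ∂Λ ≠ ⊤ := fun t => by
    refine ne_top_of_le_ne_top (ENNReal.mul_ne_top (ENNReal.natCast_ne_top n) ENNReal.coe_ne_top)
      (le_trans (lintegral_mono fun ω => ?_) hpow)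
    exact Finset.single_le_sum (f := fun t => ‖m ω t‖ₑ ^ 2) (fun _ _ => by positivity)
      (Finset.mem_univ t)
  have hEn : ∀ t, ∫⁻ p, ‖p.2 t‖ₑ ^ 2 ∂(Λ.prod γ) = 1 := fun t => by
    have := ((measurePreserving_eval (fun _ : Fin n => complexGaussian 1) t).comp
      (measurePreserving_snd (μ := Λ) (ν := γ))).lintegral_comp
        (f := fun z : ℂ => ‖z‖ₑ ^ 2) (by fun_prop)
    rw [lintegral_enorm_sq_complexGaussian] at this
    simpa using this
  have hEmp : ∀ t, ∫⁻ p, ‖m p.1 t‖ₑ ^ 2 ∂(Λ.prod γ) = ∫⁻ ω, ‖m ω t‖ₑ ^ 2 ∂Λ := fun t =>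
    (measurePreserving_fst (μ := Λ) (ν := γ)).lintegral_comp
      (f := fun ω => ‖m ω t‖ₑ ^ 2) (by fun_prop)
  have hT : MeasurePreserving (fun p : Ω × (Fin n → ℂ) => (p.1, fun t => - p.2 t))
      (Λ.prod γ) (Λ.prod γ) := (MeasurePreserving.id Λ).prod
    (measurePreserving_pi _ _ fun _ => measurePreserving_neg_complexGaussian 1)
  have hEy : ∀ t, ∫⁻ p, ‖m p.1 t + p.2 t‖ₑ ^ 2 ∂(Λ.prod γ) =
      ∫⁻ ω, ‖m ω t‖ₑ ^ 2 ∂Λ + 1 := fun t => by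
    rw [lintegral_enorm_add_sq_of_flip hT (a := fun p => m p.1 t) (b := fun p => p.2 t)
      (by fun_prop) (by fun_prop) (fun _ => rfl) (fun _ => rfl), hEn, hEmp]
  have hint : ∀ f : Ω × (Fin n → ℂ) → ℂ, Measurable f → ∫⁻ p, ‖f p‖ₑ ^ 2 ∂(Λ.prod γ) ≠ ⊤ →
      Integrable (fun p => ‖f p‖ ^ 2) (Λ.prod γ) := fun f hf h => by
    refine ⟨by fun_prop, ?_⟩
    rw [hasFiniteIntegral_iff_ofReal (ae_of_all _ fun x => sq_nonneg _)]
    simp_rw [← enorm_sq_eq_ofReal]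
    exact h.lt_top
  have hval : ∀ f : Ω × (Fin n → ℂ) → ℂ, Measurable f →
      ∫ p, ‖f p‖ ^ 2 ∂(Λ.prod γ) = (∫⁻ p, ‖f p‖ₑ ^ 2 ∂(Λ.prod γ)).toReal := fun f hf => by
    rw [integral_eq_lintegral_of_nonneg_ae (ae_of_all _ fun x => sq_nonneg _) (by fun_prop)]
    simp_rw [← enorm_sq_eq_ofReal]
  have hiy : ∀ t, Integrable (fun p => ‖m p.1 t + p.2 t‖ ^ 2) (Λ.prod γ) := fun t =>
    hint (fun p => m p.1 t + p.2 t) (by fun_prop) (by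
      rw [hEy]; exact ENNReal.add_ne_top.2 ⟨hEm t, ENNReal.one_ne_top⟩)
  have hin : ∀ t, Integrable (fun p : Ω × (Fin n → ℂ) => ‖p.2 t‖ ^ 2) (Λ.prod γ) := fun t =>
    hint (fun p => p.2 t) (by fun_prop) (by rw [hEn]; exact ENNReal.one_ne_top)
  have hcomp : (fun p : Ω × (Fin n → ℂ) => gaussianLLR (1 + τ) (m p.1) p.2) ∘
      (fun p : Ω × (Fin n → ℂ) => (p.1, m p.1 + p.2)) =
      fun p : Ω × (Fin n → ℂ) => ∑ t, (Real.log (1 + τ : ℝ≥0) +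
        (‖m p.1 t + p.2 t‖ ^ 2 / (1 + τ : ℝ≥0) - ‖p.2 t‖ ^ 2)) := by
    funext p
    simp [gaussianLLR]
  have hid : ∀ t, Integrable (fun p : Ω × (Fin n → ℂ) =>
      ‖m p.1 t + p.2 t‖ ^ 2 / (1 + τ : ℝ≥0) - ‖p.2 t‖ ^ 2) (Λ.prod γ) := fun t =>
    ((hiy t).div_const _).sub (hin t)
  have hit : ∀ t, Integrable (fun p : Ω × (Fin n → ℂ) => Real.log (1 + τ : ℝ≥0) +
        (‖m p.1 t + p.2 t‖ ^ 2 / (1 + τ : ℝ≥0) - ‖p.2 t‖ ^ 2)) (Λ.prod γ) := fun t =>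
    (integrable_const _).add (hid t)
  have hI : Integrable (fun p => gaussianLLR (1 + τ) (m p.1) p.2) ρ := by
    rw [hρ, integrable_map_measure hg.aestronglyMeasurable hmm.aemeasurable, hcomp]
    exact integrable_finsetSum _ fun t _ => hit t
  have hsum : ∑ t, (∫⁻ ω, ‖m ω t‖ₑ ^ 2 ∂Λ).toReal ≤ n * τ := by
    rw [← ENNReal.toReal_sum fun t _ => hEm t, ← lintegral_finsetSum _ fun t _ => by fun_prop]
    exact ENNReal.toReal_le_of_le_ofReal (by positivity) (by
      rw [ENNReal.ofReal_mul (by positivity), ENNReal.ofReal_natCast, ENNReal.ofReal_coe_nnreal]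
      exact hpow)
  have hbound : ∫ p, gaussianLLR (1 + τ) (m p.1) p.2 ∂ρ ≤ n * Real.log (1 + τ) := by
    rw [hρ, integral_map hmm.aemeasurable hg.aestronglyMeasurable]
    change ∫ p, ((fun p : Ω × (Fin n → ℂ) => gaussianLLR (1 + τ) (m p.1) p.2) ∘
      (fun p : Ω × (Fin n → ℂ) => (p.1, m p.1 + p.2))) p ∂_ ≤ _
    rw [hcomp, integral_finsetSum _ fun t _ => hit t]
    have hterm : ∀ t, ∫ p : Ω × (Fin n → ℂ), (Real.log (1 + τ : ℝ≥0) +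
        (‖m p.1 t + p.2 t‖ ^ 2 / (1 + τ : ℝ≥0) - ‖p.2 t‖ ^ 2)) ∂(Λ.prod γ)
        = Real.log (1 + τ) + (((∫⁻ ω, ‖m ω t‖ₑ ^ 2 ∂Λ).toReal + 1) / (1 + τ) - 1) := fun t => by
      rw [integral_add (integrable_const _) (hid t),
        integral_sub ((hiy t).div_const _) (hin t), integral_div,
        hval (fun p => m p.1 t + p.2 t) (by fun_prop), hval (fun p => p.2 t) (by fun_prop),
        hEy, hEn, ENNReal.toReal_add (hEm t) ENNReal.one_ne_top]
      simp
    simp_rw [hterm]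
    rw [Finset.sum_add_distrib, Finset.sum_sub_distrib, ← Finset.sum_div, Finset.sum_add_distrib]
    simp only [Finset.sum_const, Finset.card_univ, Fintype.card_fin, nsmul_eq_mul, mul_one]
    have : (∑ t, (∫⁻ ω, ‖m ω t‖ₑ ^ 2 ∂Λ).toReal + n) / (1 + τ) ≤ n := by
      rw [div_le_iff₀ (by positivity)]
      linarith
    linarith
  rw [klDiv_of_ac_of_integrable hac ((integrable_congr hllr).2 hI), integral_congr_ae hllr]
  simp only [probReal_univ, add_sub_cancel_right]
  exact ENNReal.ofReal_le_ofReal hbound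

/-! ### The cut between the relays and the receiver -/

lemma measurePreserving_update {ι β : Type*} [Fintype ι] [DecidableEq ι] [MeasurableSpace β]
    (μ : ι → Measure β) [∀ i, IsProbabilityMeasure (μ i)] (i : ι) :
    MeasurePreserving (fun q : (ι → β) × β => Function.update q.1 i q.2)
      ((Measure.pi μ).prod (μ i)) (Measure.pi μ) := by
  have hm : Measurable fun q : (ι → β) × β => Function.update q.1 i q.2 := by
    refine measurable_pi_iff.2 fun j => ?_
    rcases eq_or_ne j i with rfl | h
    · simpa using measurable_snd
    · simp only [Function.update_of_ne h]
      fun_prop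
  refine ⟨hm, (Measure.pi_eq fun S hS => ?_).symm⟩
  rw [Measure.map_apply hm (MeasurableSet.univ_pi hS)]
  have : (fun q : (ι → β) × β => Function.update q.1 i q.2) ⁻¹' Set.univ.pi S
      = (Set.univ.pi (Function.update S i Set.univ)) ×ˢ S i := by
    ext q
    simp only [Set.mem_preimage, Set.mem_univ_pi, Set.mem_prod]
    refine ⟨fun h => ⟨fun j => ?_, by simpa using h i⟩, fun h j => ?_⟩
    · rcases eq_or_ne j i with rfl | hj
      · simp
      · simpa [hj] using h j
    · rcases eq_or_ne j i with rfl | hj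
      · simpa using h.2
      · simpa [hj] using h.1 j
  rw [this, Measure.prod_prod, Measure.pi_pi, ← Finset.prod_erase_mul _ _ (Finset.mem_univ i),
    ← Finset.prod_erase_mul _ (fun j => μ j (S j)) (Finset.mem_univ i)]
  simp only [Function.update_self, measure_univ, mul_one]
  congr 1
  refine Finset.prod_congr rfl fun j hj => ?_
  rw [Function.update_of_ne (Finset.ne_of_mem_erase hj)]

lemma relay_ne_dst {K : ℕ} (k : Fin K) : relay k ≠ dst K := by
  intro h
  have := congrArg Fin.val h
  simp only [relay, dst, Fin.val_succ, Fin.val_castSucc, Fin.val_last] at this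
  omega

lemma relay_ne_src {K : ℕ} (k : Fin K) : relay k ≠ src K := Fin.succ_ne_zero _

lemma relay_injective {K : ℕ} : Function.Injective (relay (K := K)) := fun a b h => by
  simpa [relay] using h

namespace Scheme

variable {K : ℕ} (𝒮 : Scheme K) (G : SimpleGraph (Fin (K + 2))) (H : Gains K) (s : ℕ → ℝ)

lemma observed_update_dst (x : Fin 𝒮.slots → ℂ) (w : Fin (K + 2) → Fin 𝒮.slots → ℂ)
    (u : Fin 𝒮.slots → ℂ) (t : ℕ) (k : Fin K) :
    𝒮.observed G H s x (Function.update w (dst K) u) t k = 𝒮.observed G H s x w t k := by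
  induction t generalizing k with
  | zero => rfl
  | succ t ih => simp only [observed, ih, Function.update_of_ne (relay_ne_dst _)]

variable {𝒮 G H s}

lemma measurable_pad {Ω : Type*} [MeasurableSpace Ω] {n : ℕ} {f : Ω → Fin n → ℂ}
    (hf : Measurable f) (t : ℕ) : Measurable fun ω => pad (f ω) t := by
  unfold pad
  split_ifs <;> fun_prop

lemma measurable_emit {P : ℝ} (h𝒮 : 𝒮.Admissible G P) (k : Fin K) (t : ℕ) :
    Measurable fun past : Fin t → ℂ => 𝒮.emit H s k t past := by
  have hp : Measurable fun past : Fin t → ℂ => (H, s, past) :=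
    measurable_const.prodMk (measurable_const.prodMk measurable_id)
  have hl : Measurable fun past : Fin t → ℂ => 𝒮.listens H s k t past :=
    (h𝒮.measurable_listens k t).comp hp
  have hs : Measurable fun past : Fin t → ℂ => 𝒮.send H s k t past :=
    (h𝒮.measurable_send k t).comp hp
  exact Measurable.ite (hl (measurableSet_singleton true)) measurable_const hs

lemma measurable_observed {P : ℝ} (h𝒮 : 𝒮.Admissible G P) (t : ℕ) (k : Fin K) :
    Measurable fun p : (Fin 𝒮.slots → ℂ) × (Fin (K + 2) → Fin 𝒮.slots → ℂ) =>
      𝒮.observed G H s p.1 p.2 t k := by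
  induction t generalizing k with
  | zero => exact measurable_pi_iff.2 fun i => i.elim0
  | succ t ih =>
    refine measurable_pi_iff.2 fun i => ?_
    induction i using Fin.lastCases with
    | last =>
      simp only [observed, Fin.snoc_last]
      have hp : Measurable fun past : Fin t → ℂ => (H, s, past) :=
        measurable_const.prodMk (measurable_const.prodMk measurable_id)
      have hl : Measurable fun past : Fin t → ℂ => 𝒮.listens H s k t past :=
        (h𝒮.measurable_listens k t).comp hp
      refine Measurable.ite ((hl.comp (ih k)) (measurableSet_singleton true)) ?_ measurable_const
      unfold received
      have h1 := measurable_pad (measurable_fst (α := Fin 𝒮.slots → ℂ)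
        (β := Fin (K + 2) → Fin 𝒮.slots → ℂ)) t
      have h2 : Measurable fun p : (Fin 𝒮.slots → ℂ) × (Fin (K + 2) → Fin 𝒮.slots → ℂ) =>
        pad (p.2 (relay k)) t := measurable_pad (by fun_prop) t
      have h3 : ∀ l, Measurable fun p : (Fin 𝒮.slots → ℂ) × (Fin (K + 2) → Fin 𝒮.slots → ℂ) =>
        𝒮.emit H s l t (𝒮.observed G H s p.1 p.2 t l) := fun l =>
          (measurable_emit h𝒮 l t).comp (ih l)
      fun_prop
    | cast i =>
      simp only [observed, Fin.snoc_castSucc]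
      exact (measurable_pi_apply i).comp (ih k)

lemma measurable_relayOutput {P : ℝ} (h𝒮 : 𝒮.Admissible G P) (t : ℕ) (k : Fin K) :
    Measurable fun p : (Fin 𝒮.slots → ℂ) × (Fin (K + 2) → Fin 𝒮.slots → ℂ) =>
      𝒮.relayOutput G H s p.1 p.2 t k :=
  (measurable_emit h𝒮 k t).comp (measurable_observed h𝒮 t k)

variable (𝒮 G H s) in
/-- The noiseless part of what the receiver gets: the superposition of the relay signals. -/
noncomputable def relaySum (p : (Fin 𝒮.slots → ℂ) × (Fin (K + 2) → Fin 𝒮.slots → ℂ))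
    (t : Fin 𝒮.slots) : ℂ :=
  ∑ k : Fin K, gain G H (dst K) (relay k) * 𝒮.relayOutput G H s p.1 p.2 t k

lemma measurable_relaySum {P : ℝ} (h𝒮 : 𝒮.Admissible G P) :
    Measurable (𝒮.relaySum G H s) := by
  have := measurable_relayOutput (H := H) (s := s) h𝒮
  unfold relaySum
  fun_prop

lemma gain_dst_src (hG : IsParallelRelay G) : gain G H (dst K) (src K) = 0 :=
  if_neg fun h => hG.no_direct h.symm

lemma output_eq (hG : IsParallelRelay G) (x : Fin 𝒮.slots → ℂ)
    (w : Fin (K + 2) → Fin 𝒮.slots → ℂ) :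
    𝒮.output G H s x w = 𝒮.relaySum G H s (x, w) + w (dst K) := by
  funext t
  simp [output, received, relaySum, gain_dst_src hG]

lemma measurable_output (hG : IsParallelRelay G) {P : ℝ} (h𝒮 : 𝒮.Admissible G P) :
    Measurable fun p : (Fin 𝒮.slots → ℂ) × (Fin (K + 2) → Fin 𝒮.slots → ℂ) =>
      𝒮.output G H s p.1 p.2 := by
  simp only [output_eq hG]
  have := measurable_relaySum (H := H) (s := s) h𝒮
  fun_prop

instance : IsProbabilityMeasure 𝒮.noiseLaw := by unfold noiseLaw; infer_instance

lemma isProbabilityMeasure_jointLaw (hG : IsParallelRelay G) {P : ℝ} (h𝒮 : 𝒮.Admissible G P) :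
    IsProbabilityMeasure (𝒮.jointLaw G H s) := by
  have := h𝒮.prob_input
  exact Measure.isProbabilityMeasure_map
    (measurable_fst.prodMk (measurable_output hG h𝒮)).aemeasurable

lemma fst_jointLaw (hG : IsParallelRelay G) {P : ℝ} (h𝒮 : 𝒮.Admissible G P) :
    (𝒮.jointLaw G H s).fst = 𝒮.input := by
  have := h𝒮.prob_input
  rw [jointLaw, Measure.fst_map_prodMk (measurable_output hG h𝒮)]
  exact Measure.fst_prod

/-- The noise at the receiver is independent of the relay signals, as relays do not hear the
receiver. -/
lemma jointLaw_eq_map (hG : IsParallelRelay G) {P : ℝ} (h𝒮 : 𝒮.Admissible G P) :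
    𝒮.jointLaw G H s = ((𝒮.input.prod 𝒮.noiseLaw).prod
      (Measure.pi fun _ : Fin 𝒮.slots => complexGaussian 1)).map
        fun q => (q.1.1, 𝒮.relaySum G H s q.1 + q.2) := by
  have := h𝒮.prob_input
  have hup := measurePreserving_update (fun _ : Fin (K + 2) =>
    Measure.pi fun _ : Fin 𝒮.slots => complexGaussian 1) (dst K)
  have hmp := ((MeasurePreserving.id 𝒮.input).prod hup).comp
    ((measurePreserving_prodAssoc 𝒮.input 𝒮.noiseLaw
      (Measure.pi fun _ : Fin 𝒮.slots => complexGaussian 1)))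
  have hmeas := measurable_fst.prodMk (measurable_output (H := H) (s := s) hG h𝒮)
  rw [jointLaw]
  conv_lhs => rw [noiseLaw, ← hmp.map_eq]
  rw [Measure.map_map hmeas hmp.measurable]
  congr 1
  funext q
  have hq : 𝒮.relaySum G H s (q.1.1, Function.update q.1.2 (dst K) q.2) = 𝒮.relaySum G H s q.1 := by
    funext t
    simp only [relaySum, relayOutput, observed_update_dst]
  simp only [Function.comp, output_eq hG, Prod.map, id, MeasurableEquiv.prodAssoc,
    MeasurableEquiv.coe_mk, Equiv.prodAssoc_apply, Function.update_self, hq]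

/-- The mutual information is at most the capacity of the multiple-input channel from the relays
to the receiver, with the power of all relays together. -/
lemma mutualInfo_le (hG : IsParallelRelay G) {P : ℝ} (hP : 0 < P) (h𝒮 : 𝒮.Admissible G P) :
    𝒮.mutualInfo G H s ≤ ENNReal.ofReal (𝒮.slots * Real.log
      (1 + K * P * ∑ k : Fin K, ‖gain G H (dst K) (relay k)‖ ^ 2)) := by
  have := h𝒮.prob_input
  have := isProbabilityMeasure_jointLaw (H := H) (s := s) hG h𝒮
  set S : ℝ := ∑ k : Fin K, ‖gain G H (dst K) (relay k)‖ ^ 2 with hS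
  have hS0 : 0 ≤ S := Finset.sum_nonneg fun _ _ => sq_nonneg _
  set τ : ℝ≥0 := ⟨K * P * S, by positivity⟩ with hτ
  have hτv : (τ : ℝ) = K * P * S := rfl
  have hm := measurable_relaySum (H := H) (s := s) h𝒮
  have hcs : ∀ p t, ‖𝒮.relaySum G H s p t‖ₑ ^ 2
      ≤ ENNReal.ofReal S * ∑ k, ‖𝒮.relayOutput G H s p.1 p.2 t k‖ₑ ^ 2 := fun p t => by
    simp_rw [enorm_sq_eq_ofReal]
    rw [← ENNReal.ofReal_sum_of_nonneg fun _ _ => sq_nonneg _, ← ENNReal.ofReal_mul hS0]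
    apply ENNReal.ofReal_le_ofReal
    have h1 : ‖𝒮.relaySum G H s p t‖ ≤ ∑ k, ‖gain G H (dst K) (relay k)‖ *
        ‖𝒮.relayOutput G H s p.1 p.2 t k‖ := by
      refine (norm_sum_le _ _).trans_eq ?_
      simp_rw [norm_mul]
    calc _ ≤ (∑ k, ‖gain G H (dst K) (relay k)‖ * ‖𝒮.relayOutput G H s p.1 p.2 t k‖) ^ 2 := by
          gcongr
      _ ≤ _ := Finset.sum_mul_sq_le_sq_mul_sq _ _ _
  have hpow : ∫⁻ p, ∑ t, ‖𝒮.relaySum G H s p t‖ₑ ^ 2 ∂(𝒮.input.prod 𝒮.noiseLaw)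
      ≤ 𝒮.slots * τ := by
    have hmo := measurable_relayOutput (H := H) (s := s) h𝒮
    calc _ ≤ ∫⁻ p, ENNReal.ofReal S * ∑ k, ∑ t : Fin 𝒮.slots,
          ‖𝒮.relayOutput G H s p.1 p.2 t k‖ₑ ^ 2 ∂(𝒮.input.prod 𝒮.noiseLaw) := by
          refine lintegral_mono fun p => ?_
          rw [Finset.sum_comm, Finset.mul_sum]
          exact Finset.sum_le_sum fun t _ => hcs p t
      _ = ENNReal.ofReal S * ∑ k, ∫⁻ p, ∑ t : Fin 𝒮.slots,
          ‖𝒮.relayOutput G H s p.1 p.2 t k‖ₑ ^ 2 ∂(𝒮.input.prod 𝒮.noiseLaw) := by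
          rw [lintegral_const_mul _ (by fun_prop), lintegral_finsetSum _ fun k _ => by fun_prop]
      _ ≤ ENNReal.ofReal S * ∑ _k : Fin K, 𝒮.slots * ENNReal.ofReal P := by
          gcongr with k
          exact h𝒮.power_relay H s k
      _ = _ := by
          rw [← ENNReal.ofReal_coe_nnreal, hτv, Finset.sum_const, Finset.card_univ,
            Fintype.card_fin, nsmul_eq_mul, ENNReal.ofReal_mul (by positivity),
            ENNReal.ofReal_mul (by positivity), ENNReal.ofReal_natCast]
          ring
  set Q := Measure.pi fun _ : Fin 𝒮.slots => complexGaussian (1 + τ)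
  have hπ : Measurable fun q : ((Fin 𝒮.slots → ℂ) × (Fin (K + 2) → Fin 𝒮.slots → ℂ)) ×
    (Fin 𝒮.slots → ℂ) => (q.1.1, q.2) := by fun_prop
  have hQ : ((𝒮.input.prod 𝒮.noiseLaw).prod Q).map (fun q => (q.1.1, q.2)) = 𝒮.input.prod Q :=
    ((measurePreserving_fst (μ := 𝒮.input) (ν := 𝒮.noiseLaw)).prod (MeasurePreserving.id Q)).map_eq
  calc 𝒮.mutualInfo G H s
      ≤ klDiv (𝒮.jointLaw G H s) ((𝒮.jointLaw G H s).fst.prod Q) := klDiv_fst_prod_snd_le _ _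
    _ ≤ klDiv (((𝒮.input.prod 𝒮.noiseLaw).prod
          (Measure.pi fun _ : Fin 𝒮.slots => complexGaussian 1)).map
            fun q => (q.1, 𝒮.relaySum G H s q.1 + q.2)) ((𝒮.input.prod 𝒮.noiseLaw).prod Q) := by
        rw [fst_jointLaw hG h𝒮, ← hQ]
        have hj : 𝒮.jointLaw G H s = (((𝒮.input.prod 𝒮.noiseLaw).prod
            (Measure.pi fun _ : Fin 𝒮.slots => complexGaussian 1)).map
              fun q => (q.1, 𝒮.relaySum G H s q.1 + q.2)).map fun q => (q.1.1, q.2) := by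
          rw [Measure.map_map hπ (by fun_prop), jointLaw_eq_map hG h𝒮]
          rfl
        rw [hj]
        exact klDiv_map_le _ _ hπ
    _ ≤ _ := by
        have := klDiv_gaussianChannel_le (𝒮.input.prod 𝒮.noiseLaw) hm τ hpow
        rwa [hτv] at this

end Scheme

/-! ### The linear recursion behind sequential amplify-and-forward -/

/-- What the listening relay receives in successive slots: `x` are the transmitted symbols, `w`
the noise, `h` the gains from the transmitter, and `ρ t` is the gain with which the signal
received in slot `t - 1` interferes in slot `t`. -/
def pathSignal (h ρ x w : ℕ → ℂ) : ℕ → ℂ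
  | 0 => h 0 * x 0 + w 0
  | t + 1 => ρ (t + 1) * pathSignal h ρ x w t + (h (t + 1) * x (t + 1) + w (t + 1))

lemma pathSignal_congr {h ρ x x' w w' : ℕ → ℂ} {t : ℕ} (hx : ∀ i ≤ t, x i = x' i)
    (hw : ∀ i ≤ t, w i = w' i) : pathSignal h ρ x w t = pathSignal h ρ x' w' t := by
  induction t with
  | zero => simp [pathSignal, hx 0 le_rfl, hw 0 le_rfl]
  | succ t ih =>
    simp only [pathSignal]
    rw [ih (fun i hi => hx i (by omega)) (fun i hi => hw i (by omega)), hx _ le_rfl, hw _ le_rfl]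

/-- The last symbol enters the signal with slope `h t`. -/
lemma pathSignal_eq_mul_add {h ρ x x' w : ℕ → ℂ} {t : ℕ} (hx : ∀ i < t, x i = x' i)
    (hx' : x' t = 0) : pathSignal h ρ x w t = h t * x t + pathSignal h ρ x' w t := by
  cases t with
  | zero => simp [pathSignal, hx']
  | succ t =>
    simp only [pathSignal, hx']
    rw [pathSignal_congr (fun i hi => hx i (by omega)) (fun _ _ => rfl)]
    ring

/-- The signal is the sum of its noiseless part and of the accumulated noise. -/
lemma pathSignal_eq_add_noise (h ρ x w : ℕ → ℂ) (t : ℕ) :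
    pathSignal h ρ x w t = pathSignal h ρ x 0 t + pathSignal 0 ρ x w t := by
  induction t with
  | zero => simp [pathSignal]
  | succ t ih => simp only [pathSignal, ih, Pi.zero_apply]; ring

lemma measurable_pathSignal {Ω : Type*} [MeasurableSpace Ω] {h ρ : ℕ → ℂ} {x w : Ω → ℕ → ℂ}
    (hx : ∀ i, Measurable fun ω => x ω i) (hw : ∀ i, Measurable fun ω => w ω i) (t : ℕ) :
    Measurable fun ω => pathSignal h ρ (x ω) (w ω) t := by
  induction t with
  | zero => simp only [pathSignal]; fun_prop
  | succ t ih => simp only [pathSignal]; fun_prop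

/-! ### Second moments of the received signals -/

/-- Changing signs of symbols and of noise variables. -/
def flipSigns {A n : Type*} (δ : n → Bool) (ε : A → n → Bool) (p : (n → ℂ) × (A → n → ℂ)) :
    (n → ℂ) × (A → n → ℂ) :=
  (fun i => bif δ i then -p.1 i else p.1 i, fun a i => bif ε a i then -p.2 a i else p.2 a i)

/-- The joint law of independent symbols `𝒞𝒩(0, u i)` and of independent noise variables. -/
noncomputable def symbolNoiseLaw (A : Type*) {n : Type*} [Fintype A] [Fintype n] (u : n → ℝ≥0) :
    Measure ((n → ℂ) × (A → n → ℂ)) :=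
  (Measure.pi fun i => complexGaussian (u i)).prod
    (Measure.pi fun _ => Measure.pi fun _ => complexGaussian 1)

instance {A n : Type*} [Fintype A] [Fintype n] (u : n → ℝ≥0) :
    IsProbabilityMeasure (symbolNoiseLaw A u) := by unfold symbolNoiseLaw; infer_instance

lemma measurePreserving_flipSigns {A n : Type*} [Fintype A] [Fintype n] (u : n → ℝ≥0)
    (δ : n → Bool) (ε : A → n → Bool) :
    MeasurePreserving (flipSigns δ ε) (symbolNoiseLaw A u) (symbolNoiseLaw A u) := by
  have h : ∀ (v : ℝ≥0) (b : Bool), MeasurePreserving (fun z : ℂ => bif b then -z else z)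
      (complexGaussian v) (complexGaussian v) := fun v b => by
    cases b
    · exact MeasurePreserving.id _
    · exact measurePreserving_neg_complexGaussian v
  exact (measurePreserving_pi _ _ fun i => h (u i) (δ i)).prod
    (measurePreserving_pi _ _ fun a => measurePreserving_pi _ _ fun i => h 1 (ε a i))

lemma lintegral_symbol_sq {A n : Type*} [Fintype A] [Fintype n] (u : n → ℝ≥0) (i : n) :
    ∫⁻ p, ‖p.1 i‖ₑ ^ 2 ∂symbolNoiseLaw A u = u i := by
  have := ((measurePreserving_eval (fun i => complexGaussian (u i)) i).comp
    (measurePreserving_fst (μ := Measure.pi fun i => complexGaussian (u i))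
      (ν := Measure.pi fun _ : A => Measure.pi fun _ : n => complexGaussian 1))).lintegral_comp
        (f := fun z : ℂ => ‖z‖ₑ ^ 2) (by fun_prop)
  rw [lintegral_enorm_sq_complexGaussian] at this
  exact this

lemma lintegral_noise_sq {A n : Type*} [Fintype A] [Fintype n] (u : n → ℝ≥0) (a : A) (i : n) :
    ∫⁻ p, ‖p.2 a i‖ₑ ^ 2 ∂symbolNoiseLaw A u = 1 := by
  have := ((measurePreserving_eval (fun _ : n => complexGaussian 1) i).comp
    ((measurePreserving_eval (fun _ : A => Measure.pi fun _ : n => complexGaussian 1) a).comp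
      (measurePreserving_snd (μ := Measure.pi fun i => complexGaussian (u i))
        (ν := Measure.pi fun _ : A => Measure.pi fun _ : n => complexGaussian 1)))).lintegral_comp
          (f := fun z : ℂ => ‖z‖ₑ ^ 2) (by fun_prop)
  rw [lintegral_enorm_sq_complexGaussian, ENNReal.coe_one] at this
  exact this

lemma lintegral_mul_enorm_sq {Ω : Type*} [MeasurableSpace Ω] {μ : Measure Ω} {f : Ω → ℂ}
    (hf : Measurable f) (c : ℂ) :
    ∫⁻ ω, ‖c * f ω‖ₑ ^ 2 ∂μ = ENNReal.ofReal (‖c‖ ^ 2) * ∫⁻ ω, ‖f ω‖ₑ ^ 2 ∂μ := by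
  rw [← lintegral_const_mul _ (by fun_prop)]
  simp_rw [enorm_mul, mul_pow, enorm_sq_eq_ofReal]

section SecondMoments

variable {A : Type*} {n : ℕ} (h ρ : ℕ → ℂ) (r : ℕ → A)

/-- The signal received in slot `t`, when the noise in slot `t` is the one at node `r t`. -/
def nodeSignal (p : (Fin n → ℂ) × (A → Fin n → ℂ)) (t : ℕ) : ℂ :=
  pathSignal h ρ (pad p.1) (fun i => pad (p.2 (r i)) i) t

lemma measurable_nodeSignal (t : ℕ) :
    Measurable fun p : (Fin n → ℂ) × (A → Fin n → ℂ) => nodeSignal h ρ r p t :=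
  measurable_pathSignal (fun i => Scheme.measurable_pad measurable_fst i)
    (fun i => Scheme.measurable_pad (by fun_prop) i) t

lemma pad_of_lt {u : Fin n → ℂ} {t : ℕ} (ht : t < n) : pad u t = u ⟨t, ht⟩ := dif_pos ht

lemma lintegral_symbol_add_noise_sq [Fintype A] (u : Fin n → ℝ≥0) (c : ℂ) (a : A) (i : Fin n) :
    ∫⁻ p, ‖c * p.1 i + p.2 a i‖ₑ ^ 2 ∂symbolNoiseLaw A u
      = ENNReal.ofReal (‖c‖ ^ 2) * u i + 1 := by
  have hT := measurePreserving_flipSigns u (fun _ => false) (fun (_ : A) _ => true)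
  rw [lintegral_enorm_add_sq_of_flip hT (a := fun p => c * p.1 i) (b := fun p => p.2 a i)
    (by fun_prop) (by fun_prop) (fun _ => rfl) (fun _ => rfl), lintegral_noise_sq,
    lintegral_mul_enorm_sq (by fun_prop), lintegral_symbol_sq]

lemma lintegral_nodeSignal_zero [Fintype A] (u : Fin n → ℝ≥0) (hn : 0 < n) :
    ∫⁻ p, ‖nodeSignal h ρ r p 0‖ₑ ^ 2 ∂symbolNoiseLaw A u
      = ENNReal.ofReal (‖h 0‖ ^ 2) * u ⟨0, hn⟩ + 1 := by
  rw [← lintegral_symbol_add_noise_sq u (h 0) (r 0) ⟨0, hn⟩]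
  simp only [nodeSignal, pathSignal, pad_of_lt hn]

/-- What is new in slot `t + 1` is orthogonal to the past, since its sign can be changed. -/
lemma lintegral_nodeSignal_succ [Fintype A] (u : Fin n → ℝ≥0) {t : ℕ} (ht : t + 1 < n) :
    ∫⁻ p, ‖nodeSignal h ρ r p (t + 1)‖ₑ ^ 2 ∂symbolNoiseLaw A u
      = ENNReal.ofReal (‖ρ (t + 1)‖ ^ 2) * ∫⁻ p, ‖nodeSignal h ρ r p t‖ₑ ^ 2 ∂symbolNoiseLaw A u
        + (ENNReal.ofReal (‖h (t + 1)‖ ^ 2) * u ⟨t + 1, ht⟩ + 1) := by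
  have hT := measurePreserving_flipSigns u (fun i => decide (i.val = t + 1))
    (fun (_ : A) i => decide (i.val = t + 1))
  have hm := measurable_nodeSignal (n := n) h ρ r t
  rw [← lintegral_symbol_add_noise_sq u (h (t + 1)) (r (t + 1)) ⟨t + 1, ht⟩,
    ← lintegral_mul_enorm_sq hm, ← lintegral_enorm_add_sq_of_flip hT
      (a := fun p => ρ (t + 1) * nodeSignal h ρ r p t) (b := fun p => h (t + 1) * p.1 ⟨t + 1, ht⟩ +
        p.2 (r (t + 1)) ⟨t + 1, ht⟩) (by fun_prop) (by fun_prop)]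
  · simp only [nodeSignal, pathSignal, pad_of_lt ht]
  · intro p
    congr 1
    have hpad : ∀ (z : Fin n → ℂ) (i : ℕ), i ≤ t →
        pad (fun j => bif decide (j.val = t + 1) then -z j else z j) i = pad z i :=
      fun z i hi => by
        have h1 : ¬ i = t + 1 := by omega
        simp [pad, h1]
    exact pathSignal_congr (fun i hi => hpad _ i hi) (fun i hi => hpad _ i hi)
  · intro p
    simp only [flipSigns, decide_true, cond_true]
    ring

end SecondMoments

/-! ### The random sequential scheme as a linear channel -/

section RandomSequential

variable {K : ℕ} (hK : 0 < K) (G : SimpleGraph (Fin (K + 2))) (H : Gains K) (s : ℕ → ℝ) (P : ℝ)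

/-- The relay that listens in slot `i` and transmits in slot `i + 1`. -/
def pathRelay (i : ℕ) : Fin K := ⟨i % K, Nat.mod_lt i hK⟩

lemma pred_pathRelay_succ (i : ℕ) : pred (pathRelay hK (i + 1)) = pathRelay hK i := by
  ext
  simp only [pred, pathRelay, Nat.mod_add_mod]
  rw [show i + 1 + (K - 1) = i + K by omega, Nat.add_mod_right]

/-- The factor by which the relay of path `i` multiplies what it has received. -/
noncomputable def relayFactor (i : ℕ) : ℂ :=
  (amplification G P H (pathRelay hK i) : ℂ) * Complex.exp (2 * Real.pi * Complex.I * s i)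

/-- The gain from the transmitter to the relay of path `i`. -/
noncomputable def upGain (i : ℕ) : ℂ := gain G H (relay (pathRelay hK i)) (src K)

/-- The total gain from the relay of path `i` to the receiver. -/
noncomputable def downGain (i : ℕ) : ℂ :=
  gain G H (dst K) (relay (pathRelay hK i)) * relayFactor hK G H s P i

/-- The total gain with which path `i - 1` interferes in path `i`. -/
noncomputable def crossGain (i : ℕ) : ℂ :=
  gain G H (relay (pathRelay hK i)) (relay (pathRelay hK (i - 1))) *
    relayFactor hK G H s P (i - 1)

lemma amplification_nonneg (k : Fin K) : 0 ≤ amplification G P H k :=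
  le_min zero_le_one (Real.sqrt_nonneg _)

lemma amplification_le_one (k : Fin K) : amplification G P H k ≤ 1 := min_le_left _ _

/-- The received power (noise included) of a relay whose neighbours transmit with power `P`. -/
noncomputable def receivedPower (k : Fin K) : ℝ :=
  P * (‖gain G H (relay k) (src K)‖ ^ 2 + ‖gain G H (relay k) (relay (pred k))‖ ^ 2) + 1

variable {P} in
lemma receivedPower_pos (hP : 0 < P) (k : Fin K) : 0 < receivedPower G H P k := by
  unfold receivedPower; positivity

variable {P} in
lemma amplification_sq_mul_le (hP : 0 < P) (k : Fin K) :
    amplification G P H k ^ 2 * receivedPower G H P k ≤ P := by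
  have hD := receivedPower_pos G H hP k
  have h1 : amplification G P H k ^ 2 ≤ P / receivedPower G H P k := by
    rw [← Real.sq_sqrt (div_nonneg hP.le hD.le)]
    exact pow_le_pow_left₀ (amplification_nonneg G H P k) (min_le_right _ _) 2
  rwa [le_div_iff₀ hD] at h1

lemma norm_relayFactor (i : ℕ) :
    ‖relayFactor hK G H s P i‖ = amplification G P H (pathRelay hK i) := by
  have h1 : ‖Complex.exp (2 * Real.pi * Complex.I * s i)‖ = 1 := by
    rw [show (2 * Real.pi * Complex.I * s i : ℂ) = ((2 * Real.pi * s i : ℝ) : ℂ) * Complex.I by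
      push_cast; ring]
    exact Complex.norm_exp_ofReal_mul_I _
  rw [relayFactor, norm_mul, h1, mul_one, Complex.norm_real, Real.norm_of_nonneg
    (amplification_nonneg G H P _)]

variable (ν : Measure (ℕ → ℝ)) (B : ℕ)

lemma rs_emit_zero (k : Fin K) (past : Fin 0 → ℂ) : (rs G ν B P).emit H s k 0 past = 0 := by
  simp [Scheme.emit, rs]

lemma rs_emit_succ (k : Fin K) (t : ℕ) (past : Fin (t + 1) → ℂ) :
    (rs G ν B P).emit H s k (t + 1) past =
      if k = pathRelay hK t then relayFactor hK G H s P t * past (Fin.last t) else 0 := by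
  by_cases h : k = pathRelay hK t
  · subst h
    simp only [Scheme.emit, rs, relayFactor, pathRelay, Fin.last]
    simp
  · have h' : ¬ t % K = k.val := fun h' => h (Fin.ext h'.symm)
    simp [Scheme.emit, rs, h, h']

lemma rs_listens (hK1 : 1 < K) (t : ℕ) (past : Fin t → ℂ) :
    (rs G ν B P).listens H s (pathRelay hK t) t past = true := by
  cases t with
  | zero => simp [rs]
  | succ t =>
    have : ¬ t % K = (t + 1) % K := fun h => by
      have h1 : t ≡ t + 1 [MOD K] := h
      have h2 := (Nat.modEq_iff_dvd' (Nat.le_succ t)).1 h1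
      simp only [Nat.succ_eq_add_one, Nat.add_sub_cancel_left] at h2
      exact absurd (Nat.le_of_dvd one_pos h2) (by omega)
    simpa [rs, pathRelay] using this

variable (x : Fin (rs G ν B P).slots → ℂ) (w : Fin (K + 2) → Fin (rs G ν B P).slots → ℂ)

/-- The signal that the relay of path `t` receives in slot `t`. -/
noncomputable def relaySignal {n : ℕ} (p : (Fin n → ℂ) × (Fin (K + 2) → Fin n → ℂ)) (t : ℕ) : ℂ :=
  nodeSignal (upGain hK G H) (crossGain hK G H s P) (fun i => relay (pathRelay hK i)) p t

lemma rs_observed_last (hK1 : 1 < K) (t : ℕ) :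
    (rs G ν B P).observed G H s x w (t + 1) (pathRelay hK t) (Fin.last t)
      = relaySignal hK G H s P (x, w) t := by
  induction t with
  | zero =>
    simp only [Scheme.observed, Fin.snoc_last, rs_listens hK G H s P ν B hK1, if_true,
      rs_emit_zero]
    simp [received, relaySignal, nodeSignal, pathSignal, upGain]
  | succ t ih =>
    rw [Scheme.observed, Fin.snoc_last, if_pos (rs_listens hK G H s P ν B hK1 _ _)]
    simp only [rs_emit_succ hK]
    simp only [received, mul_ite, mul_zero, Finset.sum_ite_eq',
      Finset.mem_univ, if_true, ih]
    simp only [relaySignal, nodeSignal, pathSignal, crossGain, Nat.add_sub_cancel, upGain]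
    ring_nf

lemma rs_relayOutput_zero (k : Fin K) : (rs G ν B P).relayOutput G H s x w 0 k = 0 :=
  rs_emit_zero G H s P ν B k _

lemma rs_relayOutput_succ (hK1 : 1 < K) (t : ℕ) (k : Fin K) :
    (rs G ν B P).relayOutput G H s x w (t + 1) k =
      if k = pathRelay hK t then
        relayFactor hK G H s P t * relaySignal hK G H s P (x, w) t else 0 := by
  rw [Scheme.relayOutput, rs_emit_succ hK]
  split_ifs with h
  · rw [h, rs_observed_last hK G H s P ν B x w hK1]
  · rfl

lemma rs_output_succ (hG : IsParallelRelay G) (hK1 : 1 < K) (t : Fin (rs G ν B P).slots) (i : ℕ)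
    (ht : t.val = i + 1) :
    (rs G ν B P).output G H s x w t
      = downGain hK G H s P i * relaySignal hK G H s P (x, w) i + w (dst K) t := by
  rw [Scheme.output_eq hG, Pi.add_apply, Scheme.relaySum, ht]
  simp only [rs_relayOutput_succ hK G H s P ν B _ _ hK1, mul_ite, mul_zero, Finset.sum_ite_eq',
    Finset.mem_univ, if_true, downGain]
  ring

end RandomSequential

/-! ### The power constraints of the random sequential scheme -/

section Power

variable {K : ℕ} (hK : 0 < K) (G : SimpleGraph (Fin (K + 2))) (H : Gains K) (s : ℕ → ℝ) {P : ℝ}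

lemma measurable_relaySignal (P : ℝ) (n t : ℕ) :
    Measurable fun p : (Fin n → ℂ) × (Fin (K + 2) → Fin n → ℂ) => relaySignal hK G H s P p t :=
  measurable_nodeSignal _ _ _ t

lemma lintegral_relaySignal_sq_le (hP : 0 < P) {n : ℕ} (u : Fin n → ℝ≥0)
    (hu : ∀ i, u i ≤ P.toNNReal) {t : ℕ} (ht : t < n) :
    ∫⁻ p, ‖relaySignal hK G H s P p t‖ₑ ^ 2 ∂symbolNoiseLaw (Fin (K + 2)) u
      ≤ ENNReal.ofReal (receivedPower G H P (pathRelay hK t)) := by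
  have hu' : ∀ i, (u i : ℝ≥0∞) ≤ ENNReal.ofReal P := fun i => ENNReal.coe_le_coe.2 (hu i)
  have h1 : (1 : ℝ≥0∞) = ENNReal.ofReal 1 := by simp
  induction t with
  | zero =>
    simp only [relaySignal]
    rw [lintegral_nodeSignal_zero _ _ _ u ht]
    calc _ ≤ ENNReal.ofReal (‖upGain hK G H 0‖ ^ 2) * ENNReal.ofReal P + ENNReal.ofReal 1 := by
          rw [h1]; gcongr; exact hu' _
      _ ≤ _ := by
          rw [← ENNReal.ofReal_mul (by positivity), ← ENNReal.ofReal_add (by positivity) one_pos.le]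
          apply ENNReal.ofReal_le_ofReal
          rw [receivedPower, upGain]
          have : 0 ≤ P *
              ‖gain G H (relay (pathRelay hK 0)) (relay (pred (pathRelay hK 0)))‖ ^ 2 := by
            positivity
          linarith
  | succ t ih =>
    have ih := ih (by omega)
    simp only [relaySignal] at ih ⊢
    rw [lintegral_nodeSignal_succ _ _ _ u ht]
    have hD := receivedPower_pos G H hP (pathRelay hK t)
    have hA := amplification_sq_mul_le G H hP (pathRelay hK t)
    calc _ ≤ ENNReal.ofReal (‖crossGain hK G H s P (t + 1)‖ ^ 2) *
            ENNReal.ofReal (receivedPower G H P (pathRelay hK t)) +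
          (ENNReal.ofReal (‖upGain hK G H (t + 1)‖ ^ 2) * ENNReal.ofReal P + ENNReal.ofReal 1) := by
          rw [h1]; gcongr; exact hu' _
      _ ≤ _ := by
          rw [← ENNReal.ofReal_mul (by positivity), ← ENNReal.ofReal_mul (by positivity),
            ← ENNReal.ofReal_add (by positivity) one_pos.le,
            ← ENNReal.ofReal_add (by positivity) (by positivity)]
          apply ENNReal.ofReal_le_ofReal
          rw [upGain, crossGain, norm_mul, norm_relayFactor, Nat.add_sub_cancel]
          have e : receivedPower G H P (pathRelay hK (t + 1)) =
              P * (‖gain G H (relay (pathRelay hK (t + 1))) (src K)‖ ^ 2 +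
                ‖gain G H (relay (pathRelay hK (t + 1))) (relay (pathRelay hK t))‖ ^ 2) + 1 := by
            rw [receivedPower, pred_pathRelay_succ]
          have := mul_le_mul_of_nonneg_left hA
            (sq_nonneg ‖gain G H (relay (pathRelay hK (t + 1))) (relay (pathRelay hK t))‖)
          rw [e]
          linarith

lemma measurable_gain (a b : Fin (K + 2)) : Measurable fun H : Gains K => gain G H a b := by
  classical
  by_cases h : G.Adj a b
  · simp only [gain, if_pos h]
    exact measurable_pi_apply _
  · simp only [gain, if_neg h]
    exact measurable_const

lemma admissible_rs (hK1 : 1 < K) (ν : Measure (ℕ → ℝ)) [IsProbabilityMeasure ν] (B : ℕ)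
    (hP : 0 < P) : (rs G ν B P).Admissible G P where
  prob_seed := inferInstanceAs (IsProbabilityMeasure ν)
  prob_input := inferInstanceAs (IsProbabilityMeasure (Measure.pi _))
  measurable_listens _ _ := measurable_const
  measurable_send k t := by
    have hg := measurable_gain G (K := K)
    have ha : Measurable fun H : Gains K => amplification G P H k := by
      unfold amplification
      fun_prop
    by_cases ht : 0 < t
    · simp only [rs, dif_pos ht]
      fun_prop
    · simp only [rs, dif_neg ht]
      fun_prop
  power_input := by
    have h : ∀ t : Fin (B * K + 1), ∫⁻ x : Fin (B * K + 1) → ℂ, ‖x t‖ₑ ^ 2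
        ∂Measure.pi (fun t : Fin (B * K + 1) =>
          complexGaussian (if t.val < B * K then P.toNNReal else 0))
            ≤ ENNReal.ofReal P := fun t => by
      have := (measurePreserving_eval (fun t : Fin (B * K + 1) =>
        complexGaussian (if t.val < B * K then P.toNNReal else 0)) t).lintegral_comp
          (f := fun z : ℂ => ‖z‖ₑ ^ 2) (by fun_prop)
      rw [lintegral_enorm_sq_complexGaussian] at this
      refine this.trans_le ?_
      split_ifs
      · exact le_rfl
      · exact bot_le
    change ∫⁻ x : Fin (B * K + 1) → ℂ, ∑ t, ‖x t‖ₑ ^ 2 ∂Measure.pi (fun t : Fin (B * K + 1) =>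
      complexGaussian (if t.val < B * K then P.toNNReal else 0))
        ≤ (B * K + 1 : ℕ) * ENNReal.ofReal P
    rw [lintegral_finsetSum _ fun t _ => by fun_prop]
    refine (Finset.sum_le_sum fun t _ => h t).trans_eq ?_
    simp
  power_relay H s k := by
    have hK : 0 < K := by omega
    have hm : ∀ t, Measurable fun p : (Fin (rs G ν B P).slots → ℂ) ×
        (Fin (K + 2) → Fin (rs G ν B P).slots → ℂ) =>
          (rs G ν B P).relayOutput G H s p.1 p.2 t k := fun t => by
      cases t with
      | zero => simp only [rs_relayOutput_zero]; fun_prop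
      | succ t =>
        simp only [rs_relayOutput_succ hK G H s P ν B _ _ hK1]
        have := measurable_relaySignal hK G H s P (rs G ν B P).slots t
        split_ifs
        · fun_prop
        · fun_prop
    rw [lintegral_finsetSum _ fun t _ => by have := hm t; fun_prop]
    refine (Finset.sum_le_sum (g := fun _ => ENNReal.ofReal P) fun t _ => ?_).trans_eq (by simp)
    obtain ⟨t, ht⟩ := t
    cases t with
    | zero => simp [rs_relayOutput_zero]
    | succ t =>
      simp only [rs_relayOutput_succ hK G H s P ν B _ _ hK1]
      by_cases hk : k = pathRelay hK t
      · simp only [if_pos hk]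
        rw [lintegral_mul_enorm_sq (measurable_relaySignal hK G H s P _ t), norm_relayFactor]
        have h1 := lintegral_relaySignal_sq_le hK G H s hP (fun t : Fin (rs G ν B P).slots =>
          if t.val < B * K then P.toNNReal else 0) (fun i => by split_ifs <;> simp)
          (t := t) (by omega)
        calc _ ≤ ENNReal.ofReal (amplification G P H (pathRelay hK t) ^ 2) *
              ENNReal.ofReal (receivedPower G H P (pathRelay hK t)) := by gcongr; exact h1
          _ ≤ _ := by
              rw [← ENNReal.ofReal_mul (by positivity)]
              exact ENNReal.ofReal_le_ofReal (amplification_sq_mul_le G H hP _)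
      · simp [if_neg hk]

end Power

/-! ### A lower bound for the mutual information of the random sequential scheme -/

section FadingBound

variable {K : ℕ} (G : SimpleGraph (Fin (K + 2))) (H : Gains K)

/-- A polynomial in the channel gains that dominates all gains and all noise amplifications. -/
noncomputable def fadingBound : ℝ := ∏ e, (1 + ‖H e‖ ^ 2)

lemma prod_le_fadingBound (T : Finset (Sym2 (Fin (K + 2)))) :
    ∏ e ∈ T, (1 + ‖H e‖ ^ 2) ≤ fadingBound H :=
  Finset.prod_le_prod_of_subset_of_one_le (Finset.subset_univ T)
    (fun e _ => by positivity) fun e _ _ => by nlinarith [sq_nonneg ‖H e‖]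

lemma one_le_fadingBound : 1 ≤ fadingBound H := by simpa using prod_le_fadingBound H ∅

lemma norm_gain_le (a b : Fin (K + 2)) : ‖gain G H a b‖ ^ 2 ≤ ‖H s(a, b)‖ ^ 2 := by
  classical
  by_cases h : G.Adj a b
  · rw [gain, if_pos h]
  · rw [gain, if_neg h, norm_zero, zero_pow two_ne_zero]; positivity

lemma norm_gain_sq_le_fadingBound (a b : Fin (K + 2)) : ‖gain G H a b‖ ^ 2 ≤ fadingBound H := by
  have h1 := prod_le_fadingBound H {s(a, b)}
  rw [Finset.prod_singleton] at h1
  linarith [norm_gain_le G H a b]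

lemma receivedPower_le {P : ℝ} (hP : 1 ≤ P) (k : Fin K) :
    receivedPower G H P k ≤ P * fadingBound H := by
  have hne : s(relay k, src K) ≠ s(relay k, relay (pred k)) := by
    intro h
    rw [Sym2.congr_right] at h
    exact relay_ne_src _ h.symm
  have h1 := prod_le_fadingBound H {s(relay k, src K), s(relay k, relay (pred k))}
  rw [Finset.prod_pair hne] at h1
  have h2 := norm_gain_le G H (relay k) (src K)
  have h3 := norm_gain_le G H (relay k) (relay (pred k))
  have h4 : 0 ≤ ‖H s(relay k, src K)‖ ^ 2 * ‖H s(relay k, relay (pred k))‖ ^ 2 := by positivity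
  have h5 : 1 + ‖gain G H (relay k) (src K)‖ ^ 2 + ‖gain G H (relay k) (relay (pred k))‖ ^ 2
      ≤ fadingBound H := by nlinarith
  rw [receivedPower]
  nlinarith

lemma one_le_amplification_sq_mul {P : ℝ} (hP : 1 ≤ P) (k : Fin K) :
    1 ≤ amplification G P H k ^ 2 * fadingBound H := by
  have hP0 : 0 < P := by linarith
  have hM := one_le_fadingBound H
  have hD := receivedPower_pos G H hP0 k
  rw [amplification]
  rcases min_choice 1 (√(P / (P * (‖gain G H (relay k) (src K)‖ ^ 2 +
    ‖gain G H (relay k) (relay (pred k))‖ ^ 2) + 1))) with h | h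
  · rw [h]; linarith
  · rw [h, ← receivedPower, Real.sq_sqrt (by positivity), div_mul_eq_mul_div, one_le_div hD]
    exact receivedPower_le G H hP k

end FadingBound

/-- Donsker-Varadhan for the mutual information of a scheme: a test function bounds it from below
by its mean under the joint law and its exponential moments under independent transmission. -/
lemma Scheme.ofReal_sub_log_le_mutualInfo {K : ℕ} {𝒮 : Scheme K} {G : SimpleGraph (Fin (K + 2))}
    {H : Gains K} {s : ℕ → ℝ} {P : ℝ} (hG : IsParallelRelay G) (h𝒮 : 𝒮.Admissible G P)
    {f : (Fin 𝒮.slots → ℂ) → (Fin 𝒮.slots → ℂ) → ℝ} (hf : Measurable fun q :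
      (Fin 𝒮.slots → ℂ) × (Fin 𝒮.slots → ℂ) => f q.1 q.2) {A C : ℝ} (hC : 0 < C)
    (hfi : Integrable (fun p => f p.1 (𝒮.output G H s p.1 p.2)) (𝒮.input.prod 𝒮.noiseLaw))
    (hA : A ≤ ∫ p, f p.1 (𝒮.output G H s p.1 p.2) ∂(𝒮.input.prod 𝒮.noiseLaw))
    (hexp : ∀ x, ∫⁻ p, ENNReal.ofReal (Real.exp (f x (𝒮.output G H s p.1 p.2)))
      ∂(𝒮.input.prod 𝒮.noiseLaw) ≤ ENNReal.ofReal C) :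
    ENNReal.ofReal (A - Real.log C) ≤ 𝒮.mutualInfo G H s := by
  have := Scheme.isProbabilityMeasure_jointLaw (H := H) (s := s) hG h𝒮
  have := h𝒮.prob_input
  have hmo := Scheme.measurable_output (H := H) (s := s) hG h𝒮
  have hmj := measurable_fst.prodMk hmo
  have h1 : Integrable (fun q => f q.1 q.2) (𝒮.jointLaw G H s) := by
    rw [Scheme.jointLaw, integrable_map_measure hf.aestronglyMeasurable hmj.aemeasurable]
    exact hfi
  have h2 : A ≤ ∫ q, f q.1 q.2 ∂𝒮.jointLaw G H s := by
    rw [Scheme.jointLaw, integral_map hmj.aemeasurable hf.aestronglyMeasurable]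
    exact hA
  have h3 : ∫⁻ q, ENNReal.ofReal (Real.exp (f q.1 q.2))
      ∂((𝒮.jointLaw G H s).fst.prod (𝒮.jointLaw G H s).snd) ≤ ENNReal.ofReal C := by
    rw [Scheme.fst_jointLaw hG h𝒮, Scheme.jointLaw, Measure.snd_map_prodMk measurable_fst,
      lintegral_prod _ (by fun_prop)]
    refine lintegral_le_const (ae_of_all _ fun x => ?_)
    rw [lintegral_map (by fun_prop) hmo]
    exact hexp x
  exact le_trans (ENNReal.ofReal_le_ofReal (by linarith))
    (ofReal_integral_sub_log_le_klDiv _ _ hf h1 hC h3)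

section RandomSequential

variable {K : ℕ} (hK : 0 < K) (G : SimpleGraph (Fin (K + 2))) (H : Gains K) (s : ℕ → ℝ) (P : ℝ)

/-- The noise in the received symbol of path `i`: the noise accumulated at the relays, and the
noise at the receiver. -/
noncomputable def pathNoise {n : ℕ} (p : (Fin n → ℂ) × (Fin (K + 2) → Fin n → ℂ)) (i : ℕ) : ℂ :=
  downGain hK G H s P i *
    nodeSignal 0 (crossGain hK G H s P) (fun i => relay (pathRelay hK i)) p i +
    pad (p.2 (dst K)) (i + 1)

lemma measurable_pathNoise (n i : ℕ) :
    Measurable fun p : (Fin n → ℂ) × (Fin (K + 2) → Fin n → ℂ) => pathNoise hK G H s P p i := by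
  have h1 := measurable_nodeSignal (n := n) 0 (crossGain hK G H s P)
    (fun i => relay (pathRelay hK i)) i
  have h2 : Measurable fun p : (Fin n → ℂ) × (Fin (K + 2) → Fin n → ℂ) =>
      pad (p.2 (dst K)) (i + 1) :=
    Scheme.measurable_pad (by fun_prop) _
  unfold pathNoise
  fun_prop

/-- The noise power at the receiver is at most polynomial in the gains, uniformly in `P`. -/
lemma lintegral_pathNoise_sq_le {n : ℕ} (u : Fin n → ℝ≥0) {i : ℕ} (hi : i + 1 < n) :
    ∫⁻ p, ‖pathNoise hK G H s P p i‖ₑ ^ 2 ∂symbolNoiseLaw (Fin (K + 2)) u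
      ≤ ENNReal.ofReal ((2 * fadingBound H) ^ (i + 1)) := by
  have hM := one_le_fadingBound H
  set M := fadingBound H
  have h1 : (1 : ℝ≥0∞) = ENNReal.ofReal 1 := by simp
  have hfac : ∀ (a b : Fin (K + 2)) j, ‖gain G H a b * relayFactor hK G H s P j‖ ^ 2 ≤ M :=
    fun a b j => by
      rw [norm_mul, norm_relayFactor, mul_pow]
      have h2 := norm_gain_sq_le_fadingBound G H a b
      have h3 := amplification_le_one G H P (pathRelay hK j)
      have h4 := amplification_nonneg G H P (pathRelay hK j)
      calc _ ≤ ‖gain G H a b‖ ^ 2 * 1 := by gcongr; exact pow_le_one₀ h4 h3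
        _ ≤ M := by rwa [mul_one]
  have hstep : ∀ (c : ℂ) (j : ℕ) (a : ℝ≥0∞), ‖c‖ ^ 2 ≤ M → a ≤ ENNReal.ofReal ((2 * M) ^ j) →
      ENNReal.ofReal (‖c‖ ^ 2) * a + 1 ≤ ENNReal.ofReal ((2 * M) ^ (j + 1)) := fun c j a hc ha => by
    calc _ ≤ ENNReal.ofReal M * ENNReal.ofReal ((2 * M) ^ j) + ENNReal.ofReal 1 := by
          rw [h1]; gcongr
      _ ≤ _ := by
          rw [← ENNReal.ofReal_mul (by positivity), ← ENNReal.ofReal_add (by positivity) one_pos.le]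
          apply ENNReal.ofReal_le_ofReal
          have : 1 ≤ (2 * M) ^ j := one_le_pow₀ (by linarith)
          rw [pow_succ]
          nlinarith
  have hsig : ∀ j < n, ∫⁻ p, ‖nodeSignal 0 (crossGain hK G H s P)
      (fun i => relay (pathRelay hK i)) p j‖ₑ ^ 2 ∂symbolNoiseLaw (Fin (K + 2)) u
        ≤ ENNReal.ofReal ((2 * M) ^ j) := fun j hj => by
    induction j with
    | zero =>
      rw [lintegral_nodeSignal_zero _ _ _ u hj]
      simp
    | succ j ih =>
      rw [lintegral_nodeSignal_succ _ _ _ u hj]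
      have := hstep (crossGain hK G H s P (j + 1)) j _ (hfac _ _ _) (ih (by omega))
      simpa using this
  have hT := measurePreserving_flipSigns u (fun _ => false)
    (fun (a : Fin (K + 2)) _ => decide (a = dst K))
  have hm := measurable_nodeSignal (n := n) 0 (crossGain hK G H s P)
    (fun i => relay (pathRelay hK i)) i
  simp only [pathNoise, pad_of_lt hi]
  rw [lintegral_enorm_add_sq_of_flip hT (a := fun p => downGain hK G H s P i *
    nodeSignal 0 (crossGain hK G H s P) (fun i => relay (pathRelay hK i)) p i)
    (b := fun p => p.2 (dst K) ⟨i + 1, hi⟩) (by fun_prop) (by fun_prop) ?_ ?_,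
    lintegral_mul_enorm_sq hm, lintegral_noise_sq]
  · exact hstep _ _ _ (hfac _ _ _) (hsig i (by omega))
  · intro p
    simp [nodeSignal, flipSigns, relay_ne_dst]
  · intro p
    simp [flipSigns]

/-- The noiseless received symbol of path `i`. -/
noncomputable def pathMean {n : ℕ} (x : Fin n → ℂ) (i : ℕ) : ℂ :=
  downGain hK G H s P i * pathSignal (upGain hK G H) (crossGain hK G H s P) (pad x) 0 i

lemma measurable_pathMean (n i : ℕ) :
    Measurable fun x : Fin n → ℂ => pathMean hK G H s P x i := by
  have := measurable_pathSignal (h := upGain hK G H) (ρ := crossGain hK G H s P) (w := fun _ => 0)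
    (fun i => Scheme.measurable_pad (measurable_id (α := Fin n → ℂ)) i)
    (fun _ => measurable_const) i
  simp only [id] at this
  unfold pathMean
  fun_prop

/-- Averaged over the codeword, Gaussian bumps around displaced received symbols factor, because
the channel is triangular. -/
lemma lintegral_prod_exp_le {P : ℝ} (hP : 0 < P) (L : ℕ)
    (hne : ∀ i < L, downGain hK G H s P i * upGain hK G H i ≠ 0)
    (w : ℕ → ℂ) (c : ℕ → ℂ) {b : ℝ} (hb : 0 < b) :
    ∫⁻ x, ∏ i : Fin L, ENNReal.ofReal (Real.exp (-‖downGain hK G H s P i *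
        pathSignal (upGain hK G H) (crossGain hK G H s P) (pad x) w i + c i‖ ^ 2 / b))
      ∂Measure.pi (fun t : Fin (L + 1) => complexGaussian (if t.val < L then P.toNNReal else 0))
      ≤ ∏ i : Fin L, ENNReal.ofReal
        (b / (P * ‖downGain hK G H s P i * upGain hK G H i‖ ^ 2)) := by
  set a : ℕ → ℂ := fun i => downGain hK G H s P i * upGain hK G H i
  set d : (i : ℕ) → (Fin i → ℂ) → ℂ := fun i p => downGain hK G H s P i *
    pathSignal (upGain hK G H) (crossGain hK G H s P) (pad p) w i + c i
  have hd : ∀ i, Measurable (d i) := fun i => by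
    have := measurable_pathSignal (h := upGain hK G H) (ρ := crossGain hK G H s P) (w := fun _ => w)
      (fun j => Scheme.measurable_pad (measurable_id (α := Fin i → ℂ)) j)
      (fun _ => measurable_const) i
    simp only [id] at this
    fun_prop
  set F : (i : ℕ) → (Fin i → ℂ) → ℂ → ℝ≥0∞ := fun i p z =>
    if i < L then ENNReal.ofReal (Real.exp (-‖a i * z + d i p‖ ^ 2 / b)) else 1 with hFdef
  have hF : ∀ i, Measurable fun q : (Fin i → ℂ) × ℂ => F i q.1 q.2 := fun i => by
    have := hd i
    simp only [hFdef]
    split_ifs <;> fun_prop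
  have hP' : (P.toNNReal : ℝ) = P := Real.coe_toNNReal _ hP.le
  have key := lintegral_pi_prod_le (L + 1)
    (fun t => complexGaussian (if t < L then P.toNNReal else 0)) F hF
    (fun i => if i < L then ENNReal.ofReal (b / (P * ‖a i‖ ^ 2)) else 1) (fun i hi p => by
      by_cases hiL : i < L
      · simp only [hFdef, if_pos hiL]
        refine (lintegral_exp_affine_le (Real.toNNReal_pos.2 hP).ne' (hne i hiL) (d i p)
          hb).trans_eq ?_
        rw [hP']
      · simp only [hFdef, if_neg hiL]
        simp)
  simp only [Fin.prod_univ_castSucc, hFdef, Fin.val_castSucc, Fin.val_last, Fin.is_lt, if_true,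
    lt_irrefl, if_false, mul_one] at key
  refine le_trans (le_of_eq (lintegral_congr fun x => Finset.prod_congr rfl fun i _ => ?_)) key
  congr 4
  have hx : pad x (i : ℕ) = x i.castSucc := pad_of_lt (u := x) (by omega : (i : ℕ) < L + 1)
  rw [pathSignal_eq_mul_add (x := pad x) (x' := pad fun j : Fin (i : ℕ) => x ⟨j, by omega⟩)
    (t := i) ?_ ?_, hx]
  · simp only [a, d]
    ring_nf
  · intro j hj
    rw [pad_of_lt hj, pad_of_lt (by omega : j < L + 1)]
  · simp [pad]

lemma rs_output_sub_pathMean (hG : IsParallelRelay G) (hK1 : 1 < K) (ν : Measure (ℕ → ℝ)) (B : ℕ)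
    (x : Fin (rs G ν B P).slots → ℂ) (w : Fin (K + 2) → Fin (rs G ν B P).slots → ℂ) (i : ℕ)
    (hi : i + 1 < (rs G ν B P).slots) :
    (rs G ν B P).output G H s x w ⟨i + 1, hi⟩ - pathMean hK G H s P x i
      = pathNoise hK G H s P (x, w) i := by
  rw [rs_output_succ hK G H s P ν B x w hG hK1 _ i rfl, relaySignal, nodeSignal,
    pathSignal_eq_add_noise, pathMean, pathNoise, nodeSignal, pad_of_lt hi]
  ring

variable {P} in
/-- The Donsker-Varadhan bound with the test function `- ∑ |y_{i+1} - E[y_{i+1} | x]|² / b`, where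
`b` bounds the noise power. -/
lemma mutualInfo_rs_ge_sum_log (hG : IsParallelRelay G) (hK1 : 1 < K) (ν : Measure (ℕ → ℝ))
    [IsProbabilityMeasure ν] (B : ℕ) (hP : 0 < P)
    (hne : ∀ i < B * K, downGain hK G H s P i * upGain hK G H i ≠ 0) :
    ENNReal.ofReal (-(B * K : ℕ) - ∑ i : Fin (B * K), Real.log ((2 * fadingBound H) ^ (B * K) /
      (P * ‖downGain hK G H s P i * upGain hK G H i‖ ^ 2))) ≤ (rs G ν B P).mutualInfo G H s := by
  have hadm := admissible_rs G hK1 ν B hP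
  have hM := one_le_fadingBound H
  set b : ℝ := (2 * fadingBound H) ^ (B * K) with hb
  have hb0 : 0 < b := by positivity
  have hmo := Scheme.measurable_output (H := H) (s := s) hG hadm
  have hidx : ∀ i : Fin (B * K), (i : ℕ) + 1 < (rs G ν B P).slots := fun i => Nat.succ_lt_succ i.2
  have hmean := fun i => measurable_pathMean hK G H s P (rs G ν B P).slots i
  have hnoise := fun i => measurable_pathNoise hK G H s P (rs G ν B P).slots i
  have hN : ∀ i : Fin (B * K), ∫⁻ p, ‖pathNoise hK G H s P p i‖ₑ ^ 2
      ∂((rs G ν B P).input.prod (rs G ν B P).noiseLaw) ≤ ENNReal.ofReal b := fun i => by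
    refine (lintegral_pathNoise_sq_le hK G H s P (fun t : Fin (rs G ν B P).slots =>
      if t.val < B * K then P.toNNReal else 0) (hidx i)).trans (ENNReal.ofReal_le_ofReal ?_)
    exact pow_le_pow_right₀ (by linarith) i.2
  have hint : ∀ i : Fin (B * K), Integrable (fun p => ‖pathNoise hK G H s P p i‖ ^ 2 / b)
      ((rs G ν B P).input.prod (rs G ν B P).noiseLaw) := fun i => by
    refine Integrable.div_const ⟨by have := hnoise i; fun_prop, ?_⟩ b
    rw [hasFiniteIntegral_iff_ofReal (ae_of_all _ fun x => sq_nonneg _)]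
    simp_rw [← enorm_sq_eq_ofReal]
    exact (hN i).trans_lt ENNReal.ofReal_lt_top
  have hprodpos : ∀ i : Fin (B * K),
      0 < b / (P * ‖downGain hK G H s P i * upGain hK G H i‖ ^ 2) := fun i => by
    have := norm_pos_iff.2 (hne i i.2)
    positivity
  rw [← Real.log_prod fun i _ => (hprodpos i).ne']
  have := hadm.prob_input
  refine Scheme.ofReal_sub_log_le_mutualInfo hG hadm
    (f := fun x y => -∑ i : Fin (B * K), ‖y ⟨i + 1, hidx i⟩ - pathMean hK G H s P x i‖ ^ 2 / b)
    ?_ (Finset.prod_pos fun i _ => hprodpos i) ?_ ?_ fun x => ?_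
  · have : ∀ i : Fin (B * K), Measurable fun q : (Fin (rs G ν B P).slots → ℂ) ×
        (Fin (rs G ν B P).slots → ℂ) => pathMean hK G H s P q.1 i := fun i =>
      (hmean i).comp measurable_fst
    fun_prop
  · simp only [rs_output_sub_pathMean hK G H s P hG hK1]
    exact (integrable_finsetSum _ fun i _ => hint i).neg
  · simp only [rs_output_sub_pathMean hK G H s P hG hK1]
    rw [integral_neg, integral_finsetSum _ fun i _ => hint i, neg_le_neg_iff]
    calc _ ≤ ∑ _i : Fin (B * K), (1 : ℝ) := by
          refine Finset.sum_le_sum fun i _ => ?_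
          rw [integral_div, div_le_one hb0,
            integral_eq_lintegral_of_nonneg_ae (ae_of_all _ fun x => sq_nonneg _)
              (by have := hnoise i; fun_prop)]
          simp_rw [← enorm_sq_eq_ofReal]
          exact ENNReal.toReal_le_of_le_ofReal hb0.le (hN i)
      _ = (B * K : ℕ) := by simp
  · rw [ENNReal.ofReal_prod_of_nonneg fun i _ => (hprodpos i).le]
    have hsplit : ∀ (z : Fin (rs G ν B P).slots → ℂ)
        (w : Fin (K + 2) → Fin (rs G ν B P).slots → ℂ),
        ENNReal.ofReal (Real.exp (-∑ i : Fin (B * K), ‖(rs G ν B P).output G H s z w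
          ⟨i + 1, hidx i⟩ - pathMean hK G H s P x i‖ ^ 2 / b)) =
        ∏ i : Fin (B * K), ENNReal.ofReal (Real.exp (-‖downGain hK G H s P i *
          pathSignal (upGain hK G H) (crossGain hK G H s P) (pad z)
            (fun j => pad (w (relay (pathRelay hK j))) j) i +
              (pad (w (dst K)) (i + 1) - pathMean hK G H s P x i)‖ ^ 2 / b)) := fun z w => by
      rw [← ENNReal.ofReal_prod_of_nonneg fun _ _ => (Real.exp_pos _).le, ← Real.exp_sum,
        ← Finset.sum_neg_distrib]
      congr 2
      refine Finset.sum_congr rfl fun i _ => ?_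
      rw [rs_output_succ hK G H s P ν B z w hG hK1 _ i rfl, relaySignal, nodeSignal,
        pad_of_lt (u := w (dst K)) (hidx i), add_sub_assoc, neg_div]
    have hmeas : Measurable fun p : (Fin (rs G ν B P).slots → ℂ) ×
        (Fin (K + 2) → Fin (rs G ν B P).slots → ℂ) =>
          ENNReal.ofReal (Real.exp (-∑ i : Fin (B * K), ‖(rs G ν B P).output G H s p.1 p.2
          ⟨i + 1, hidx i⟩ - pathMean hK G H s P x i‖ ^ 2 / b)) := by fun_prop
    rw [lintegral_prod_symm _ hmeas.aemeasurable]
    refine lintegral_le_const (ae_of_all _ fun w => ?_)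
    refine (lintegral_congr fun z => hsplit z w).trans_le ?_
    exact lintegral_prod_exp_le hK G H s hP (B * K) hne _
      (fun i => pad (w (dst K)) (i + 1) - pathMean hK G H s P x i) hb0

end RandomSequential

/-! ### Outage probability of the random sequential scheme -/

section Outage

variable {K : ℕ}

instance isProbabilityMeasure_gainLaw (v : Sym2 (Fin (K + 2)) → ℝ≥0) :
    IsProbabilityMeasure (gainLaw v) := by unfold gainLaw; infer_instance

/-- The edges of the two-hop paths: those from the transmitter to the relays, and those from the
relays to the receiver. -/
def hopEdge : Fin K ⊕ Fin K → Sym2 (Fin (K + 2)) :=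
  Sum.elim (fun k => s(relay k, src K)) (fun k => s(dst K, relay k))

lemma src_ne_dst : src K ≠ dst K := by
  intro h
  have := congrArg Fin.val h
  simp [src, dst] at this

lemma hopEdge_injective : Function.Injective (hopEdge (K := K)) := by
  rintro (k | k) (l | l) h
  · exact congrArg Sum.inl (relay_injective (Sym2.congr_left.1 h))
  · rcases Sym2.eq_iff.1 h with h | h
    · exact absurd h.1 (relay_ne_dst k)
    · exact absurd h.2 src_ne_dst
  · rcases Sym2.eq_iff.1 h with h | h
    · exact absurd h.1.symm (relay_ne_dst l)
    · exact absurd h.1.symm src_ne_dst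
  · exact congrArg Sum.inr (relay_injective (Sym2.congr_right.1 h))

lemma hopEdge_mem_edgeSet {G : SimpleGraph (Fin (K + 2))} (hG : IsParallelRelay G)
    (j : Fin K ⊕ Fin K) : hopEdge j ∈ G.edgeSet := by
  rcases j with k | k
  · exact (hG.uplink k).symm
  · exact (hG.downlink k).symm

lemma sum_pathRelay (hK : 0 < K) (B : ℕ) (f : Fin K → ℝ) :
    ∑ i : Fin (B * K), f (pathRelay hK i) = B * ∑ k, f k := by
  rw [Fin.sum_univ_eq_sum_range (fun i => f (pathRelay hK i)) (B * K)]
  induction B with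
  | zero => simp
  | succ B ih =>
    rw [Nat.succ_mul, Finset.sum_range_add, ih,
      ← Fin.sum_univ_eq_sum_range (fun x => f (pathRelay hK (B * K + x))) K]
    have : ∀ k : Fin K, pathRelay hK (B * K + k) = k := fun k => by
      ext
      simp [pathRelay, Nat.mod_eq_of_lt k.2]
    simp only [this]
    push_cast
    ring

/-- If the random sequential scheme is in outage, the two-hop gains are small, up to a factor
that is polynomial in the channel gains. -/
lemma rpow_le_of_outage (hK1 : 1 < K) {G : SimpleGraph (Fin (K + 2))} (hG : IsParallelRelay G)
    (ν : Measure (ℕ → ℝ)) [IsProbabilityMeasure ν] {B : ℕ} (hB : 0 < B) {r P : ℝ} (hr : 0 ≤ r)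
    (hP : 1 ≤ P) {H : Gains K} {s : ℕ → ℝ} (hH : ∀ j, H (hopEdge j) ≠ 0)
    (hout : (rs G ν B P).mutualInfo G H s
      ≤ ENNReal.ofReal ((rs G ν B P).slots * (r * Real.log P))) :
    P ^ ((K : ℝ) * (1 - r) - r / B) ≤
      Real.exp K * (2 * fadingBound H) ^ ((B * K + 1) * K) * ∏ j, (‖H (hopEdge j)‖ ^ 2)⁻¹ := by
  have hK : 0 < K := by omega
  have hP0 : 0 < P := by linarith
  have hB0 : (0 : ℝ) < B := by exact_mod_cast hB
  have hlogP := Real.log_nonneg hP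
  have hM := one_le_fadingBound H
  set M := fadingBound H
  have hU : ∀ k, gain G H (relay k) (src K) = H (hopEdge (Sum.inl k)) := fun k =>
    if_pos (hG.uplink k).symm
  have hD : ∀ k, gain G H (dst K) (relay k) = H (hopEdge (Sum.inr k)) := fun k =>
    if_pos (hG.downlink k).symm
  have hjpos : ∀ j, 0 < ‖H (hopEdge j)‖ ^ 2 := fun j => by
    have := norm_pos_iff.2 (hH j)
    positivity
  set q : Fin K → ℝ := fun k =>
    ‖H (hopEdge (Sum.inr k))‖ ^ 2 * ‖H (hopEdge (Sum.inl k))‖ ^ 2 with hq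
  have hq0 : ∀ k, 0 < q k := fun k => mul_pos (hjpos _) (hjpos _)
  have ha : ∀ i, ‖downGain hK G H s P i * upGain hK G H i‖ ^ 2
      = amplification G P H (pathRelay hK i) ^ 2 * q (pathRelay hK i) := fun i => by
    rw [downGain, upGain, norm_mul, norm_mul, norm_relayFactor, hU, hD]
    simp only [hq]
    ring
  have hα : ∀ k, 1 ≤ amplification G P H k ^ 2 * M := one_le_amplification_sq_mul G H hP
  have hα0 : ∀ k, 0 < amplification G P H k ^ 2 := fun k => by
    by_contra h
    have h0 : amplification G P H k ^ 2 = 0 := le_antisymm (not_lt.1 h) (sq_nonneg _)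
    have := hα k
    rw [h0] at this
    linarith
  have hne : ∀ i < B * K, downGain hK G H s P i * upGain hK G H i ≠ 0 := fun i _ h => by
    have h1 := ha i
    rw [h, norm_zero] at h1
    have := mul_pos (hα0 (pathRelay hK i)) (hq0 (pathRelay hK i))
    rw [← h1] at this
    norm_num at this
  set A : ℝ := (2 * M) ^ (B * K + 1) with hA
  have hA0 : 0 < A := by positivity
  have hterm : ∀ i, Real.log ((2 * M) ^ (B * K) /
      (P * ‖downGain hK G H s P i * upGain hK G H i‖ ^ 2)) ≤
        Real.log A - Real.log P - Real.log (q (pathRelay hK i)) := fun i => by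
    have hqi := hq0 (pathRelay hK i)
    have hαi := hα0 (pathRelay hK i)
    rw [← Real.log_div hA0.ne' hP0.ne', ← Real.log_div (by positivity) hqi.ne', ha]
    refine Real.log_le_log (by positivity) ?_
    rw [div_div, div_le_div_iff₀ (by positivity) (by positivity), hA, pow_succ]
    have h1 := hα (pathRelay hK i)
    have h2 : 0 ≤ (2 * M) ^ (B * K) * (P * q (pathRelay hK i)) := by positivity
    nlinarith [mul_le_mul_of_nonneg_left h1 h2]
  have h1 := (ENNReal.ofReal_le_ofReal_iff (mul_nonneg (Nat.cast_nonneg _)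
    (mul_nonneg hr hlogP))).1 ((mutualInfo_rs_ge_sum_log hK G H s hG hK1 ν B hP0 hne).trans hout)
  have h2 := Finset.sum_le_sum fun (i : Fin (B * K)) (_ : i ∈ Finset.univ) => hterm i
  have h3 := sum_pathRelay hK B fun k => Real.log A - Real.log P - Real.log (q k)
  rw [h3, Finset.sum_sub_distrib, Finset.sum_const, Finset.card_univ, Fintype.card_fin,
    nsmul_eq_mul] at h2
  have hs : ((rs G ν B P).slots : ℝ) = B * K + 1 := by simp [rs]
  rw [hs] at h1
  push_cast at h1
  -- Each relay serves `B` of the `B K` paths while the codeword takes `B K + 1` slots: division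
  -- by `B` leaves the rate loss `r / B`.
  have h4 : ((K : ℝ) * (1 - r) - r / B) * Real.log P
      ≤ K + K * Real.log A - ∑ k, Real.log (q k) := by
    refine le_of_mul_le_mul_left ?_ hB0
    have : (B : ℝ) * (((K : ℝ) * (1 - r) - r / B) * Real.log P)
      = B * K * Real.log P - (B * K + 1) * (r * Real.log P) := by field_simp; ring
    rw [this]
    linarith
  have hW : Real.log (Real.exp K * (2 * M) ^ ((B * K + 1) * K) * ∏ j, (‖H (hopEdge j)‖ ^ 2)⁻¹)
      = K + K * Real.log A - ∑ k, Real.log (q k) := by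
    have hprod : ∏ j, (‖H (hopEdge j)‖ ^ 2)⁻¹ = (∏ k, q k)⁻¹ := by
      rw [Finset.prod_inv_distrib, Fintype.prod_sum_type, hq, Finset.prod_mul_distrib, mul_comm]
    have hqp : 0 < ∏ k, q k := Finset.prod_pos fun k _ => hq0 k
    rw [hprod, Real.log_mul (by positivity) (by positivity), Real.log_mul (by positivity)
      (by positivity), Real.log_exp, Real.log_inv, Real.log_prod fun k _ => (hq0 k).ne', pow_mul,
      Real.log_pow]
    ring
  have hWpos : 0 < Real.exp K * (2 * M) ^ ((B * K + 1) * K) * ∏ j, (‖H (hopEdge j)‖ ^ 2)⁻¹ :=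
    mul_pos (by positivity) (Finset.prod_pos fun j _ => inv_pos.2 (hjpos j))
  rw [← Real.log_le_log_iff (by positivity) hWpos, Real.log_rpow hP0, hW]
  exact h4

/-- Markov's inequality for the power `θ < 1` of the inverse two-hop gains: the outage probability
of the random sequential scheme decays like `P` to the power `-θ (K (1 - r) - r / B)`. -/
lemma exists_outage_rs_le (hK1 : 1 < K) {G : SimpleGraph (Fin (K + 2))} (hG : IsParallelRelay G)
    {v : Sym2 (Fin (K + 2)) → ℝ≥0} (hv : ∀ e ∈ G.edgeSet, 0 < v e)
    (ν : Measure (ℕ → ℝ)) [IsProbabilityMeasure ν] {B : ℕ} (hB : 0 < B) {r : ℝ} (hr : 0 ≤ r)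
    {θ : ℝ} (hθ0 : 0 ≤ θ) (hθ : θ < 1) :
    ∃ C : ℝ, 0 < C ∧ ∀ P : ℝ, 1 ≤ P → (rs G ν B P).outage G v r P ≤
      ENNReal.ofReal (C * P ^ (-(θ * ((K : ℝ) * (1 - r) - r / B)))) := by
  classical
  set d := (K : ℝ) * (1 - r) - r / B with hd
  set N := (B * K + 1) * K with hN
  set T : Finset (Sym2 (Fin (K + 2))) := Finset.univ.image (hopEdge (K := K)) with hT
  -- The bound on the inverse gains is a product over the edges, hence its mean factors; on the
  -- edges of two-hop paths a negative moment appears, on the others only a polynomial.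
  set φ : Sym2 (Fin (K + 2)) → ℂ → ℝ := fun e z =>
    (1 + ‖z‖ ^ 2) ^ N * (if e ∈ T then (‖z‖ ^ 2) ^ (-θ) else 1) with hφ
  have hφ0 : ∀ e z, 0 ≤ φ e z := fun e z => by
    simp only [hφ]
    split_ifs <;> positivity
  have hφm : ∀ e, Measurable fun z => ENNReal.ofReal (φ e z) := fun e => by
    simp only [hφ]
    split_ifs <;> fun_prop
  set c₀ : ℝ := Real.exp K * 2 ^ N with hc₀
  have hc₀1 : 1 ≤ c₀ := by
    have h1 : 1 ≤ Real.exp K := Real.one_le_exp (by positivity)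
    have h2 : (1 : ℝ) ≤ 2 ^ N := one_le_pow₀ (by norm_num)
    nlinarith
  set I : ℝ≥0∞ := ∫⁻ H, ∏ e, ENNReal.ofReal (φ e (H e)) ∂gainLaw v with hI
  have hIt : I < ⊤ := by
    rw [hI, gainLaw, lintegral_pi_prod _ _ hφm]
    refine ENNReal.prod_lt_top fun e _ => ?_
    by_cases he : e ∈ T
    · obtain ⟨j, -, rfl⟩ := Finset.mem_image.1 he
      simp only [hφ, if_pos he]
      exact lintegral_moment_lt_top (hv _ (hopEdge_mem_edgeSet hG j)).ne' N hθ
    · simp only [hφ, if_neg he, mul_one]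
      exact lintegral_one_add_norm_sq_pow_lt_top (v e) N
  have hnull : gainLaw v {H | ∃ j, H (hopEdge j) = 0} = 0 := by
    rw [Set.ofPred_exists]
    refine measure_iUnion_null fun j => ?_
    have := (measurePreserving_eval (fun e => complexGaussian (v e)) (hopEdge j)).measure_preimage
      (measurableSet_singleton 0).nullMeasurableSet
    rw [complexGaussian_singleton_zero (hv _ (hopEdge_mem_edgeSet hG j)).ne'] at this
    exact this
  refine ⟨c₀ * I.toReal + 1, by positivity, fun P hP => ?_⟩
  have hP0 : 0 < P := by linarith
  have hsub : {p : Gains K × (ℕ → ℝ) | (rs G ν B P).mutualInfo G p.1 p.2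
      ≤ ENNReal.ofReal ((rs G ν B P).slots * (r * Real.log P))} ⊆
      ({H | ∃ j, H (hopEdge j) = 0} ∪ {H | ENNReal.ofReal (P ^ (θ * d)) ≤
        ENNReal.ofReal c₀ * ∏ e, ENNReal.ofReal (φ e (H e))}) ×ˢ Set.univ := by
    rintro ⟨H, s⟩ hp
    refine ⟨?_, trivial⟩
    by_cases hH : ∃ j, H (hopEdge j) = 0
    · exact Or.inl hH
    refine Or.inr ?_
    have hH' : ∀ j, H (hopEdge j) ≠ 0 := fun j h => hH ⟨j, h⟩
    have h1 := rpow_le_of_outage hK1 hG ν hB hr hP hH' hp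
    have hM := one_le_fadingBound H
    set M := fadingBound H
    have hj0 : ∀ j, 0 ≤ (‖H (hopEdge j)‖ ^ 2)⁻¹ := fun j => by positivity
    have h2 : ∏ e, φ e (H e) = M ^ N * ∏ j, ((‖H (hopEdge j)‖ ^ 2)⁻¹) ^ θ := by
      simp only [hφ]
      rw [Finset.prod_mul_distrib, Finset.prod_pow, Finset.prod_ite_mem, Finset.univ_inter, hT,
        Finset.prod_image fun _ _ _ _ h => hopEdge_injective h]
      congr 1
      refine Finset.prod_congr rfl fun j _ => ?_
      rw [Real.rpow_neg (by positivity), Real.inv_rpow (by positivity)]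
    change ENNReal.ofReal (P ^ (θ * d)) ≤ ENNReal.ofReal c₀ * ∏ e, ENNReal.ofReal (φ e (H e))
    rw [← ENNReal.ofReal_prod_of_nonneg fun e _ => hφ0 e _, ← ENNReal.ofReal_mul (by positivity),
      h2]
    apply ENNReal.ofReal_le_ofReal
    have h3 : c₀ * M ^ N = Real.exp K * (2 * M) ^ N := by rw [mul_pow, hc₀]; ring
    have h4 : 1 ≤ c₀ * M ^ N := one_le_mul_of_one_le_of_one_le hc₀1 (one_le_pow₀ hM)
    calc P ^ (θ * d) = (P ^ d) ^ θ := by rw [mul_comm, Real.rpow_mul hP0.le]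
      _ ≤ (c₀ * M ^ N * ∏ j, (‖H (hopEdge j)‖ ^ 2)⁻¹) ^ θ := by
          rw [h3]
          exact Real.rpow_le_rpow (by positivity) h1 hθ0
      _ = (c₀ * M ^ N) ^ θ * ∏ j, ((‖H (hopEdge j)‖ ^ 2)⁻¹) ^ θ := by
          rw [Real.mul_rpow (by positivity) (Finset.prod_nonneg fun j _ => hj0 j),
            Real.finsetProd_rpow _ _ fun j _ => hj0 j]
      _ ≤ (c₀ * M ^ N) ^ (1 : ℝ) * ∏ j, ((‖H (hopEdge j)‖ ^ 2)⁻¹) ^ θ := by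
          gcongr
      _ = _ := by rw [Real.rpow_one]; ring
  have hΦm : Measurable fun H : Gains K => ∏ e, ENNReal.ofReal (φ e (H e)) :=
    Finset.measurable_prod _ fun e _ => (hφm e).comp (measurable_pi_apply e)
  have hPd : 0 < P ^ (θ * d) := by positivity
  calc (rs G ν B P).outage G v r P
      ≤ ((gainLaw v).prod ν) _ := measure_mono hsub
    _ ≤ gainLaw v {H | ENNReal.ofReal (P ^ (θ * d)) ≤
        ENNReal.ofReal c₀ * ∏ e, ENNReal.ofReal (φ e (H e))} := by
        rw [Measure.prod_prod, measure_univ, mul_one]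
        refine (measure_union_le _ _).trans_eq ?_
        rw [hnull, zero_add]
    _ ≤ (∫⁻ H, ENNReal.ofReal c₀ * ∏ e, ENNReal.ofReal (φ e (H e)) ∂gainLaw v) /
        ENNReal.ofReal (P ^ (θ * d)) :=
        meas_ge_le_lintegral_div (hΦm.const_mul _).aemeasurable (by simpa using hPd)
          ENNReal.ofReal_ne_top
    _ = ENNReal.ofReal (c₀ * I.toReal) / ENNReal.ofReal (P ^ (θ * d)) := by
        have h : ENNReal.ofReal (c₀ * I.toReal) = ENNReal.ofReal c₀ * I := by
          rw [ENNReal.ofReal_mul (zero_le_one.trans hc₀1), ENNReal.ofReal_toReal hIt.ne]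
        rw [lintegral_const_mul _ hΦm, h]
    _ ≤ _ := by
        rw [← ENNReal.ofReal_div_of_pos hPd, Real.rpow_neg hP0.le, ← div_eq_mul_inv]
        apply ENNReal.ofReal_le_ofReal
        gcongr
        linarith

end Outage

/-! ### Outage probability of arbitrary schemes -/

lemma ofReal_prod_le_gainLaw {K : ℕ} (v : Sym2 (Fin (K + 2)) → ℝ≥0) {c : Fin K → ℝ}
    (hc : ∀ k, 0 < c k) {δ : ℝ} (hδ : 0 ≤ δ)
    (h : ∀ k, ENNReal.ofReal (c k * δ) ≤
      complexGaussian (v (hopEdge (Sum.inr k))) {z | ‖z‖ ^ 2 ≤ δ}) :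
    ENNReal.ofReal (∏ k, (c k * δ)) ≤
      gainLaw v {H | ∀ k : Fin K, ‖H (hopEdge (Sum.inr k))‖ ^ 2 ≤ δ} := by
  classical
  set T : Finset (Sym2 (Fin (K + 2))) := Finset.univ.image fun k : Fin K => hopEdge (Sum.inr k)
    with hT
  have hinj : Function.Injective fun k : Fin K => hopEdge (K := K) (Sum.inr k) :=
    hopEdge_injective.comp Sum.inr_injective
  have hset : {H : Gains K | ∀ k : Fin K, ‖H (hopEdge (Sum.inr k))‖ ^ 2 ≤ δ} =
      Set.univ.pi fun e => {z : ℂ | e ∈ T → ‖z‖ ^ 2 ≤ δ} := by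
    ext H
    simp [hT, Set.mem_pi]
  have hmeas : ∀ e, complexGaussian (v e) {z : ℂ | e ∈ T → ‖z‖ ^ 2 ≤ δ} =
      if e ∈ T then complexGaussian (v e) {z | ‖z‖ ^ 2 ≤ δ} else 1 := fun e => by
    by_cases he : e ∈ T
    · simp only [he, if_true, forall_const]
    · simp [he]
  rw [hset, gainLaw, Measure.pi_pi, ENNReal.ofReal_prod_of_nonneg fun k _ =>
    mul_nonneg (hc k).le hδ]
  simp only [hmeas]
  rw [Finset.prod_ite_mem, Finset.univ_inter, hT, Finset.prod_image fun _ _ _ _ h => hinj h]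
  exact Finset.prod_le_prod' fun k _ => h k

/-- With probability of order `P ^ (-K max(0, 1 - r))` all gains to the receiver are so small that
no scheme with power `P` achieves the rate `r log P`. -/
lemma exists_le_outage {K : ℕ} (hK : 0 < K) {G : SimpleGraph (Fin (K + 2))} (hG : IsParallelRelay G)
    {v : Sym2 (Fin (K + 2)) → ℝ≥0} (hv : ∀ e ∈ G.edgeSet, 0 < v e) {r : ℝ} (hr : 0 < r) :
    ∃ c : ℝ, 0 < c ∧ ∀ᶠ P : ℝ in atTop, ∀ 𝒮 : Scheme K, 𝒮.Admissible G P →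
      ENNReal.ofReal (c * P ^ (-((K : ℝ) * max 0 (1 - r)))) ≤ 𝒮.outage G v r P := by
  have hK1 : (1 : ℝ) ≤ K := by exact_mod_cast hK
  set q := max 0 (1 - r) with hq
  have hq0 : 0 ≤ q := le_max_left _ _
  have hqr : 1 - q ≤ r := by linarith [le_max_right 0 (1 - r)]
  choose c hc hball using fun k : Fin K => exists_le_complexGaussian_ball
    (hv _ (hopEdge_mem_edgeSet hG (Sum.inr k))).ne'
  refine ⟨∏ k, (c k / (2 * K ^ 2)), Finset.prod_pos fun k _ => div_pos (hc k) (by positivity), ?_⟩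
  filter_upwards [eventually_ge_atTop 1, (tendsto_rpow_atTop hr).eventually_ge_atTop 2]
    with P hP hPr 𝒮 h𝒮
  have hP0 : 0 < P := by linarith
  have := h𝒮.prob_seed
  set δ := P ^ (-q) / (2 * K ^ 2) with hδ
  have hδ0 : 0 ≤ δ := by positivity
  have hδ1 : δ ≤ 1 := by
    rw [hδ, div_le_one (by positivity)]
    calc P ^ (-q) ≤ 1 := Real.rpow_le_one_of_one_le_of_nonpos hP (by linarith)
      _ ≤ 2 * (K : ℝ) ^ 2 := by nlinarith
  -- With gains this small, `1 + K P ∑ k, |h k|² ≤ 1 + P ^ (1 - q) / 2`, which is below `P ^ r`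
  -- as soon as `2 ≤ P ^ r`; this is where `0 < r` is needed.
  have hsub : {H : Gains K | ∀ k : Fin K, ‖H (hopEdge (Sum.inr k))‖ ^ 2 ≤ δ} ×ˢ Set.univ ⊆
      {p : Gains K × (ℕ → ℝ) | 𝒮.mutualInfo G p.1 p.2
        ≤ ENNReal.ofReal (𝒮.slots * (r * Real.log P))} := by
    rintro ⟨H, s⟩ ⟨hH, -⟩
    refine (Scheme.mutualInfo_le hG hP0 h𝒮).trans (ENNReal.ofReal_le_ofReal ?_)
    have hgain : ∑ k : Fin K, ‖gain G H (dst K) (relay k)‖ ^ 2 ≤ K * δ := by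
      calc _ ≤ ∑ _k : Fin K, δ := Finset.sum_le_sum fun k _ =>
            (norm_gain_le G H (dst K) (relay k)).trans (hH k)
        _ = K * δ := by simp
    rw [← Real.log_rpow hP0]
    gcongr
    have h1 : P ^ (1 - q) ≤ P ^ r := Real.rpow_le_rpow_of_exponent_le hP hqr
    have h2 : P * P ^ (-q) = P ^ (1 - q) := by
      rw [sub_eq_add_neg, Real.rpow_add hP0, Real.rpow_one]
    calc 1 + K * P * ∑ k : Fin K, ‖gain G H (dst K) (relay k)‖ ^ 2 ≤ 1 + K * P * (K * δ) := by
          gcongr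
      _ = 1 + P * P ^ (-q) / 2 := by rw [hδ]; field_simp
      _ ≤ P ^ r := by rw [h2]; linarith
  calc ENNReal.ofReal ((∏ k, (c k / (2 * K ^ 2))) * P ^ (-((K : ℝ) * q)))
      = ENNReal.ofReal (∏ k, (c k * δ)) := by
        congr 1
        have h1 : P ^ (-((K : ℝ) * q)) = ∏ _k : Fin K, P ^ (-q) := by
          rw [Finset.prod_const, Finset.card_univ, Fintype.card_fin, ← Real.rpow_natCast,
            ← Real.rpow_mul hP0.le]
          congr 1
          ring
        rw [h1, ← Finset.prod_mul_distrib]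
        refine Finset.prod_congr rfl fun k _ => ?_
        rw [hδ]
        ring
    _ ≤ gainLaw v {H | ∀ k : Fin K, ‖H (hopEdge (Sum.inr k))‖ ^ 2 ≤ δ} :=
        ofReal_prod_le_gainLaw v hc hδ0 fun k => hball k δ hδ0 hδ1
    _ = ((gainLaw v).prod 𝒮.seedLaw)
        ({H | ∀ k : Fin K, ‖H (hopEdge (Sum.inr k))‖ ^ 2 ≤ δ} ×ˢ Set.univ) := by
        rw [Measure.prod_prod, measure_univ, mul_one]
    _ ≤ 𝒮.outage G v r P := measure_mono hsub

/-! ### Decay exponents -/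

lemma neg_log_div_log_eq {C d P : ℝ} (hC : 0 < C) (hP : 1 < P) :
    -ENNReal.log (ENNReal.ofReal (C * P ^ (-d))) / (Real.log P : EReal)
      = ((d - Real.log C / Real.log P : ℝ) : EReal) := by
  have hP0 : 0 < P := by linarith
  have hlog := Real.log_pos hP
  rw [ENNReal.log_ofReal_of_pos (by positivity), ← EReal.coe_neg, ← EReal.coe_div,
    Real.log_mul hC.ne' (by positivity), Real.log_rpow hP0]
  congr 1
  field_simp
  ring

lemma tendsto_sub_log_div_log (C d : ℝ) :
    Tendsto (fun P : ℝ => ((d - Real.log C / Real.log P : ℝ) : EReal)) atTop (𝓝 (d : EReal)) := by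
  refine (continuous_coe_real_ereal.tendsto d).comp ?_
  have h := (tendsto_const_nhds (x := Real.log C)).div_atTop Real.tendsto_log_atTop
  simpa using h.const_sub d

lemma le_liminf_of_le_rpow {f : ℝ → ℝ≥0∞} {C d : ℝ} (hC : 0 < C)
    (h : ∀ᶠ P in atTop, f P ≤ ENNReal.ofReal (C * P ^ (-d))) :
    (d : EReal) ≤ liminf (fun P : ℝ => -ENNReal.log (f P) / (Real.log P : EReal)) atTop := by
  rw [← (tendsto_sub_log_div_log C d).liminf_eq]
  refine liminf_le_liminf ?_
  filter_upwards [h, eventually_gt_atTop 1] with P hf hP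
  rw [← neg_log_div_log_eq hC hP]
  exact EReal.div_le_div_right_of_nonneg (EReal.coe_nonneg.2 (Real.log_pos hP).le)
    (EReal.neg_le_neg_iff.2 (ENNReal.log_le_log hf))

lemma liminf_le_of_rpow_le {f : ℝ → ℝ≥0∞} {C d : ℝ} (hC : 0 < C)
    (h : ∀ᶠ P in atTop, ENNReal.ofReal (C * P ^ (-d)) ≤ f P) :
    liminf (fun P : ℝ => -ENNReal.log (f P) / (Real.log P : EReal)) atTop ≤ d := by
  rw [← (tendsto_sub_log_div_log C d).liminf_eq]
  refine liminf_le_liminf ?_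
  filter_upwards [h, eventually_gt_atTop 1] with P hf hP
  rw [← neg_log_div_log_eq hC hP]
  exact EReal.div_le_div_right_of_nonneg (EReal.coe_nonneg.2 (Real.log_pos hP).le)
    (EReal.neg_le_neg_iff.2 (ENNReal.log_le_log hf))

section Tradeoff

variable {K : ℕ} {G : SimpleGraph (Fin (K + 2))} {v : Sym2 (Fin (K + 2)) → ℝ≥0}

lemma le_diversityGain_rs (hK : 1 < K) (hG : IsParallelRelay G) (hv : ∀ e ∈ G.edgeSet, 0 < v e)
    (ν : Measure (ℕ → ℝ)) [IsProbabilityMeasure ν] {B : ℕ} (hB : 0 < B) {r : ℝ} (hr : 0 ≤ r) :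
    ((max 0 ((K : ℝ) * (1 - r) - r / (B : ℝ)) : ℝ) : EReal) ≤
      diversityGain G v (rs G ν B) r := by
  set d := (K : ℝ) * (1 - r) - r / (B : ℝ) with hd
  have key : ∀ θ : ℝ, 0 ≤ θ → θ < 1 → ((θ * d : ℝ) : EReal) ≤ diversityGain G v (rs G ν B) r :=
    fun θ h0 h1 => by
      obtain ⟨C, hC, h⟩ := exists_outage_rs_le hK hG hv ν hB hr h0 h1
      exact le_liminf_of_le_rpow hC ((eventually_ge_atTop 1).mono h)
  rw [EReal.coe_strictMono.monotone.map_max]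
  refine max_le (by simpa using key 0 le_rfl one_pos) ?_
  have hlim : Tendsto (fun θ : ℝ => ((θ * d : ℝ) : EReal)) (𝓝[<] 1) (𝓝 (d : EReal)) := by
    refine (continuous_coe_real_ereal.tendsto d).comp ?_
    have : Tendsto (fun θ : ℝ => θ * d) (𝓝 1) (𝓝 (1 * d)) := tendsto_id.mul_const d
    rw [one_mul] at this
    exact this.mono_left nhdsWithin_le_nhds
  refine le_of_tendsto hlim ?_
  filter_upwards [Ioo_mem_nhdsLT (zero_lt_one' ℝ)] with θ hθ
  exact key θ hθ.1.le hθ.2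

lemma diversityGain_le (hK : 1 < K) (hG : IsParallelRelay G) (hv : ∀ e ∈ G.edgeSet, 0 < v e)
    {r : ℝ} (hr : 0 < r) {𝒮 : ℝ → Scheme K} (h𝒮 : ∀ P, 0 < P → (𝒮 P).Admissible G P) :
    diversityGain G v 𝒮 r ≤ (((K : ℝ) * max 0 (1 - r) : ℝ) : EReal) := by
  obtain ⟨c, hc, h⟩ := exists_le_outage (by omega) hG hv hr
  refine liminf_le_of_rpow_le hc ?_
  filter_upwards [h, eventually_gt_atTop 0] with P hP hP0
  exact hP _ (h𝒮 P hP0)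

lemma tendsto_tradeoff (K : ℕ) (r : ℝ) :
    Tendsto (fun B : ℕ => ((max 0 ((K : ℝ) * (1 - r) - r / (B : ℝ)) : ℝ) : EReal)) atTop
      (𝓝 (((K : ℝ) * max 0 (1 - r) : ℝ) : EReal)) := by
  refine (continuous_coe_real_ereal.tendsto _).comp ?_
  have h := ((tendsto_const_div_atTop_nhds_zero_nat r).const_sub ((K : ℝ) * (1 - r)))
  rw [sub_zero] at h
  rw [mul_max_of_nonneg _ _ (Nat.cast_nonneg K), mul_zero]
  exact tendsto_const_nhds.max h

end Tradeoff

end RelayNet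

theorem theorem3 (K : ℕ) (hK : 1 < K) (G : SimpleGraph (Fin (K + 2)))
    (hG : RelayNet.IsParallelRelay G) (v : Sym2 (Fin (K + 2)) → ℝ≥0)
    (hv : ∀ e ∈ G.edgeSet, 0 < v e) (ν : Measure (ℕ → ℝ)) [IsProbabilityMeasure ν] :
    (∀ B : ℕ, ∀ P : ℝ, 0 < P → (RelayNet.rs G ν B P).Admissible G P) ∧
    (∀ B : ℕ, 0 < B → ∀ r : ℝ, 0 ≤ r →
      ((max 0 ((K : ℝ) * (1 - r) - r / (B : ℝ)) : ℝ) : EReal) ≤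
        RelayNet.diversityGain G v (RelayNet.rs G ν B) r) ∧
    (∀ r : ℝ, 0 < r →
      RelayNet.optimalDMT G v r = (((K : ℝ) * max 0 (1 - r) : ℝ) : EReal) ∧
      Tendsto (fun B : ℕ => RelayNet.diversityGain G v (RelayNet.rs G ν B) r) atTop
        (𝓝 (RelayNet.optimalDMT G v r))) := by
  have hadm : ∀ B : ℕ, ∀ P : ℝ, 0 < P → (RelayNet.rs G ν B P).Admissible G P :=
    fun B P hP => RelayNet.admissible_rs G hK ν B hP
  have hle : ∀ r : ℝ, 0 < r → ∀ᶠ B : ℕ in atTop,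
      ((max 0 ((K : ℝ) * (1 - r) - r / (B : ℝ)) : ℝ) : EReal) ≤
        RelayNet.diversityGain G v (RelayNet.rs G ν B) r := fun r hr => by
    filter_upwards [eventually_gt_atTop 0] with B hB
    exact RelayNet.le_diversityGain_rs hK hG hv ν hB hr.le
  refine ⟨hadm, fun B hB r hr => RelayNet.le_diversityGain_rs hK hG hv ν hB hr, fun r hr => ?_⟩
  have hopt : RelayNet.optimalDMT G v r = (((K : ℝ) * max 0 (1 - r) : ℝ) : EReal) := by
    refine le_antisymm (sSup_le ?_) (le_of_tendsto (RelayNet.tendsto_tradeoff K r) ?_)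
    · rintro d ⟨𝒮, h𝒮, rfl⟩
      exact RelayNet.diversityGain_le hK hG hv hr h𝒮
    · filter_upwards [hle r hr] with B hB
      exact hB.trans (le_sSup ⟨_, hadm B, rfl⟩)
  refine ⟨hopt, ?_⟩
  rw [hopt]
  exact tendsto_of_tendsto_of_tendsto_of_le_of_le' (RelayNet.tendsto_tradeoff K r)
    tendsto_const_nhds (hle r hr)
    (Eventually.of_forall fun B => RelayNet.diversityGain_le hK hG hv hr (hadm B))
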